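/- Let $d,m\in\mathbb N$, $T>0$, $r_0>0$, $0<\beta,\delta\le 1$ and $$0<\alpha<\alpha_0:=\min\Big\{\tfrac12,\ \beta,\ \tfrac{\delta}{1+\delta}\Big\}.$$ For $a<b$ let $W_0^{\alpha,\infty}(a,b;\mathbb R^d)$ be the space of measurable $f:[a,b]\to\mathbb R^d$ with $$\sup_{t\in[a,b]}\Big(|f(t)|+\int_a^t\frac{|f(t)-f(s)|}{(t-s)^{\alpha+1}}\,ds\Big)<\infty ,$$ write $\|f\|_{\alpha,\infty}$ for this supremum when $[a,b]=[0,T]$, and let $C^{\lambda}(a,b;\mathbb R^d)$ be the space of $\lambda$-Hölder continuous functions on $[a,b]$. Let $g:[0,T]\to\mathbb R^m$ be measurable with $$\sup_{0<s<t<T}\Big(\frac{|g(t)-g(s)|}{(t-s)^{1-\alpha}}+\int_s^t\frac{|g(u)-g(s)|}{(u-s)^{2-\alpha}}\,du\Big)<\infty ,$$ i.e. $g\in W_T^{1-\alpha,\infty}(0,T;\mathbb R^m)$. Integrals with respect to $g$ are (componentwise) the generalized Stieltjes integrals of Zähle, $$\int_0^t f\,dg=(-1)^\alpha\int_0^t D_{0+}^{\alpha}f(s)\,D_{t-}^{1-\alpha}g_{t-}(s)\,ds,\qquad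 g_{t-}(s)=g(s)-g(t-),$$ where $D_{0+}^\alpha$ and $D_{t-}^{1-\alpha}$ are the Weyl fractional derivatives. Assume: (H1) $\sigma:[0,T]\times\mathbb R^d\to\mathbb R^{d\times m}$ is measurable, differentiable in $x$, and for every $N\ge0$ there is $M_N>0$ such that, for all $s,t\in[0,T]$ and each $i=1,\dots,d$: $|\sigma(t,x)-\sigma(t,y)|\le M_0|x-y|$ for all $x,y\in\mathbb R^d$; $|\partial_{x_i}\sigma(t,x)-\partial_{x_i}\sigma(t,y)|\le M_N|x-y|^\delta$ whenever $|x|,|y|\le N$; and $|\sigma(t,x)-\sigma(s,x)|+|\partial_{x_i}\sigma(t,x)-\partial_{x_i}\sigma(s,x)|\le M_0|t-s|^\beta$ for all $x\in\mathbb R^d$. (H2') $b:[0,T]\times\mathbb R^d\to\mathbb R^d$ is measurable, and there are $b_0\in L^{1/\alpha}(0,T)$ and, for every $N\ge0$, a constant $L_N>0$ such that, for all $t\in[0,T]$: $|b(t,x)-b(t,y)|\le L_N|x-y|$ whenever $|x|,|y|\le N$; and $|b(t,x)|\le L_0|x|+b_0(t)$ for all $x\in\mathbb R^d$. Let $\eta\in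 W_0^{\alpha,\infty}(-r_0,0;\mathbb R^d)\cap C^{1-\alpha}(-r_0,0;\mathbb R^d)$. For $0<r\le r_0$ let $x^r\in W_0^{\alpha,\infty}(-r,T;\mathbb R^d)$ be a solution of the delay equation $$x^r(t)=\eta(0)+\int_0^t b(s,x^r(s))\,ds+\int_0^t\sigma(s,x^r(s-r))\,dg_s,\quad t\in(0,T],\qquad x^r(t)=\eta(t),\quad t\in[-r,0],$$ and let $x\in W_0^{\alpha,\infty}(0,T;\mathbb R^d)$ be a solution of the equation without delay $$x(t)=\eta(0)+\int_0^t b(s,x(s))\,ds+\int_0^t\sigma(s,x(s))\,dg_s,\quad t\in[0,T].$$ Then $$\lim_{r\downarrow0}\|x-x^r\|_{\alpha,\infty}=0 .$$ -/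

import Mathlib

open Set Filter Topology MeasureTheory
open scoped ENNReal

noncomputable section

namespace DelayEq

/-- `f` is measurable as a function on the interval `[a,b]`. -/
def MeasOn {E : Type*} [MeasurableSpace E] (a b : ℝ) (f : ℝ → E) : Prop :=
  Measurable (fun t : Icc a b => f t)

/-- The norm `sup_{t ∈ [a,b]} ( |f(t)| + ∫_a^t |f(t)-f(s)| / (t-s)^{α+1} ds )`, with values in
`[0,∞]`. -/
def wNorm {E : Type*} [NormedAddCommGroup E] (α a b : ℝ) (f : ℝ → E) : ℝ≥0∞ :=
  ⨆ t ∈ Icc a b, (ENNReal.ofReal ‖f t‖ +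
    ∫⁻ s in Ioo a t, ENNReal.ofReal (‖f t - f s‖ / (t - s) ^ (α + 1)))

/-- The space `W_0^{α,∞}(a,b;E)`. -/
def MemW {E : Type*} [NormedAddCommGroup E] [MeasurableSpace E] (α a b : ℝ) (f : ℝ → E) : Prop :=
  MeasOn a b f ∧ wNorm α a b f < ∞

/-- The norm `sup_{t ∈ [a,b]} |f(t)| + sup_{a ≤ s < t ≤ b} |f(t)-f(s)| / (t-s)^l`, with values in
`[0,∞]`. -/
def holderNorm {E : Type*} [NormedAddCommGroup E] (l a b : ℝ) (f : ℝ → E) : ℝ≥0∞ :=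
  (⨆ t ∈ Icc a b, ENNReal.ofReal ‖f t‖) +
    ⨆ s ∈ Icc a b, ⨆ t ∈ Ioc s b, ENNReal.ofReal (‖f t - f s‖ / (t - s) ^ l)

/-- The space `C^l(a,b;E)` of `l`-Hölder continuous functions on `[a,b]`. -/
def MemHolder {E : Type*} [NormedAddCommGroup E] (l a b : ℝ) (f : ℝ → E) : Prop :=
  holderNorm l a b f < ∞

/-- The norm `sup_{0<s<t<T} ( |g(t)-g(s)| / (t-s)^{1-α} + ∫_s^t |g(u)-g(s)| / (u-s)^{2-α} du )`,
with values in `[0,∞]`. -/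
def wTNorm {E : Type*} [NormedAddCommGroup E] (α T : ℝ) (g : ℝ → E) : ℝ≥0∞ :=
  ⨆ s ∈ Ioo 0 T, ⨆ t ∈ Ioo s T, (ENNReal.ofReal (‖g t - g s‖ / (t - s) ^ (1 - α)) +
    ∫⁻ u in Ioo s t, ENNReal.ofReal (‖g u - g s‖ / (u - s) ^ (2 - α)))

/-- The space `W_T^{1-α,∞}(0,T;E)`. -/
def MemWT {E : Type*} [NormedAddCommGroup E] [MeasurableSpace E] (α T : ℝ) (g : ℝ → E) : Prop :=
  MeasOn 0 T g ∧ wTNorm α T g < ∞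

/-- The left-sided Weyl derivative `D_{a+}^γ f` at `x > a`. -/
def weylLeft (γ a : ℝ) (f : ℝ → ℝ) (x : ℝ) : ℝ :=
  (Real.Gamma (1 - γ))⁻¹ *
    (f x / (x - a) ^ γ + γ * ∫ y in a..x, (f x - f y) / (x - y) ^ (γ + 1))

/-- The right-sided Weyl derivative `D_{b-}^γ g` at `x < b`, without the conventional complex
factor `(-1)^γ`. -/
def weylRight (γ b : ℝ) (g : ℝ → ℝ) (x : ℝ) : ℝ :=
  (Real.Gamma (1 - γ))⁻¹ *
    (g x / (b - x) ^ γ + γ * ∫ y in x..b, (g x - g y) / (y - x) ^ (γ + 1))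

/-- The generalized (Zähle) Stieltjes integral
`∫_a^b f dg = (-1)^α ∫_a^b D_{a+}^α f(x) D_{b-}^{1-α} g_{b-}(x) dx`, where
`g_{b-}(x) = g(x) - g(b-)`. The minus sign is `(-1)^α (-1)^{1-α}`. -/
def stieltjes (α a b : ℝ) (f g : ℝ → ℝ) : ℝ :=
  -∫ x in a..b, weylLeft α a f x *
    weylRight (1 - α) b (fun u => g u - Function.leftLim g b) x

/-- The `ℝ^d`-valued integral `∫_0^t A(s) dg_s` of a `d × m` matrix-valued function against an
`ℝ^m`-valued function: its `i`-th component is `∑_j ∫_0^t A_{ij}(s) dg^j_s`. -/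
def vecStieltjes {d m : ℕ} (α t : ℝ) (A : ℝ → EuclideanSpace ℝ (Fin d × Fin m))
    (g : ℝ → EuclideanSpace ℝ (Fin m)) : EuclideanSpace ℝ (Fin d) :=
  WithLp.toLp 2 fun i => ∑ j, stieltjes α 0 t (fun s => A s (i, j)) (fun s => g s j)

/-- The partial derivative `∂_{x_i} σ(t,x)`. -/
def partialX {d m : ℕ} (σ : ℝ → EuclideanSpace ℝ (Fin d) → EuclideanSpace ℝ (Fin d × Fin m))
    (i : Fin d) (t : ℝ) (x : EuclideanSpace ℝ (Fin d)) : EuclideanSpace ℝ (Fin d × Fin m) :=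
  fderiv ℝ (σ t) x (EuclideanSpace.single i 1)

/-- The hypothesis on the diffusion coefficient `σ`, with exponents `β` and `δ`; `d × m` matrices
carry the Euclidean norm of their entries. -/
def HypH1 {d m : ℕ} (T β δ : ℝ)
    (σ : ℝ → EuclideanSpace ℝ (Fin d) → EuclideanSpace ℝ (Fin d × Fin m)) : Prop :=
  Measurable (fun p : Icc (0 : ℝ) T × EuclideanSpace ℝ (Fin d) => σ p.1 p.2) ∧
  (∀ t ∈ Icc 0 T, Differentiable ℝ (σ t)) ∧
  ∃ M : ℝ → ℝ, (∀ N, 0 ≤ N → 0 < M N) ∧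
    (∀ t ∈ Icc 0 T, ∀ x y, ‖σ t x - σ t y‖ ≤ M 0 * ‖x - y‖) ∧
    (∀ N, 0 ≤ N → ∀ t ∈ Icc 0 T, ∀ x y, ‖x‖ ≤ N → ‖y‖ ≤ N → ∀ i,
      ‖partialX σ i t x - partialX σ i t y‖ ≤ M N * ‖x - y‖ ^ δ) ∧
    (∀ t ∈ Icc 0 T, ∀ s ∈ Icc 0 T, ∀ x, ∀ i,
      ‖σ t x - σ s x‖ + ‖partialX σ i t x - partialX σ i s x‖ ≤ M 0 * |t - s| ^ β)

/-- The hypothesis on the drift coefficient `b`, with integrability exponent `ρ`. -/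
def HypH2' {d : ℕ} (T ρ : ℝ)
    (b : ℝ → EuclideanSpace ℝ (Fin d) → EuclideanSpace ℝ (Fin d)) : Prop :=
  Measurable (fun p : Icc (0 : ℝ) T × EuclideanSpace ℝ (Fin d) => b p.1 p.2) ∧
  ∃ (b₀ : ℝ → ℝ) (L : ℝ → ℝ),
    MemLp b₀ (ENNReal.ofReal ρ) (volume.restrict (Icc 0 T)) ∧
    (∀ N, 0 ≤ N → 0 < L N) ∧
    (∀ N, 0 ≤ N → ∀ t ∈ Icc 0 T, ∀ x y, ‖x‖ ≤ N → ‖y‖ ≤ N →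
      ‖b t x - b t y‖ ≤ L N * ‖x - y‖) ∧
    (∀ t ∈ Icc 0 T, ∀ x, ‖b t x‖ ≤ L 0 * ‖x‖ + b₀ t)

/-- `x ∈ W_0^{α,∞}(-r,T;ℝ^d)` solves the delay equation
`x(t) = η(0) + ∫_0^t b(s,x(s)) ds + ∫_0^t σ(s,x(s-r)) dg_s` for `t ∈ (0,T]`, and `x = η` on
`[-r,0]`. -/
def IsDelaySolution {d m : ℕ} (α T r : ℝ)
    (b : ℝ → EuclideanSpace ℝ (Fin d) → EuclideanSpace ℝ (Fin d))
    (σ : ℝ → EuclideanSpace ℝ (Fin d) → EuclideanSpace ℝ (Fin d × Fin m))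
    (g : ℝ → EuclideanSpace ℝ (Fin m)) (η x : ℝ → EuclideanSpace ℝ (Fin d)) : Prop :=
  MemW α (-r) T x ∧
  (∀ t ∈ Ioc 0 T, x t = η 0 + (∫ s in (0 : ℝ)..t, b s (x s)) +
    vecStieltjes α t (fun s => σ s (x (s - r))) g) ∧
  ∀ t ∈ Icc (-r) 0, x t = η t

/-- `x ∈ W_0^{α,∞}(0,T;ℝ^d)` solves the equation without delay
`x(t) = x₀ + ∫_0^t b(s,x(s)) ds + ∫_0^t σ(s,x(s)) dg_s` for `t ∈ [0,T]`. -/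
def IsSolution {d m : ℕ} (α T : ℝ)
    (b : ℝ → EuclideanSpace ℝ (Fin d) → EuclideanSpace ℝ (Fin d))
    (σ : ℝ → EuclideanSpace ℝ (Fin d) → EuclideanSpace ℝ (Fin d × Fin m))
    (g : ℝ → EuclideanSpace ℝ (Fin m)) (x₀ : EuclideanSpace ℝ (Fin d))
    (x : ℝ → EuclideanSpace ℝ (Fin d)) : Prop :=
  MemW α 0 T x ∧
  ∀ t ∈ Icc 0 T, x t = x₀ + (∫ s in (0 : ℝ)..t, b s (x s)) +
    vecStieltjes α t (fun s => σ s (x s)) g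

end DelayEq

end

noncomputable section

namespace DelayEq

/-! Let h = x - x^r. It satisfies an integral equation with drift b(s,x(s)) - b(s,x^r(s)) and
diffusion σ(s,x(s)) - σ(s,x^r(s-r)). The drift is Lipschitz in h. The diffusion, measured in the
pointwise norm `wPt`, is controlled by h plus the error of replacing x^r(s) by x^r(s-r). That error
is of order r^(1/2-α), and a Gronwall inequality transfers this rate to h.

Stieltjes part. The integrals of f over [0,s] and over [0,t] involve the same left derivative, based
at 0, so their difference only sees the right derivative near t and its change when the endpoint
moves from s to t. This gives `incrementBound_stieltjes`. Inserting such an increment bound into the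
W-norm and exchanging integrations produces the single kernel (t-u)^(-α) u^(-α)
(`IncrementBound.exists_le`), using α < 1/2. Inequalities with this kernel are closed by
`gronwall_kernel`, through an exponentially weighted supremum.

Coefficient part. A second-order difference of σ is estimated along two segments
(`norm_four_point_le`). Its terms scale in time like (u-s)^β, (u-s)^((1-α)δ) and, from the delay,
(u-s)^(1/2). All three must beat the singularity (u-s)^(-α-1), and the three bounds on α in the
hypothesis say exactly that: β > α, (1-α)δ > α and 1/2 > α. The delay term is obtained by
interpolation: a (1-α)-Hölder bound is split into r^(1/2-α) and (u-s)^(1/2) (`norm_delay_sub_le`).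
These estimates are combined in `HypH1.exists_wPt_sub_le`.

Uniformity. The local constants of b and ∂σ, and the Hölder constant above, must not depend on r.
Linear growth and the same Gronwall inequality bound all delayed solutions at once
(`exists_wPt_delay_le`); their increments then give a common Hölder constant
(`exists_holder_delay`). -/

/-! ### Power integrals and the Beta integral. -/

/-- The power `x ^ p` of a real number, as an extended nonnegative real. -/
def epow (x p : ℝ) : ℝ≥0∞ := ENNReal.ofReal (x ^ p)

lemma epow_ne_top (x p : ℝ) : epow x p ≠ ∞ := ENNReal.ofReal_ne_top

@[fun_prop]
lemma measurable_epow {X : Type*} [MeasurableSpace X] {f : X → ℝ} (hf : Measurable f) (p : ℝ) :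
    Measurable fun x => epow (f x) p :=
  (hf.pow_const p).ennreal_ofReal

lemma epow_mul_epow {x : ℝ} (hx : 0 < x) (p q : ℝ) : epow x p * epow x q = epow x (p + q) := by
  rw [epow, epow, epow, ← ENNReal.ofReal_mul (Real.rpow_nonneg hx.le _), ← Real.rpow_add hx]

lemma epow_anti {x y p : ℝ} (hx : 0 < x) (hxy : x ≤ y) (hp : p ≤ 0) : epow y p ≤ epow x p :=
  ENNReal.ofReal_le_ofReal (Real.rpow_le_rpow_of_nonpos hx hxy hp)

lemma epow_mono {x y p : ℝ} (hx : 0 ≤ x) (hxy : x ≤ y) (hp : 0 ≤ p) : epow x p ≤ epow y p :=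
  ENNReal.ofReal_le_ofReal (Real.rpow_le_rpow hx hxy hp)

lemma epow_zero (x : ℝ) : epow x 0 = 1 := by simp [epow]

lemma epow_mul_neg {x : ℝ} (hx : 0 < x) (p : ℝ) : epow x p * epow x (-p) = 1 := by
  rw [epow_mul_epow hx, add_neg_cancel, epow_zero]

lemma ofReal_div_rpow {a x : ℝ} (ha : 0 ≤ a) (hx : 0 < x) (p : ℝ) :
    ENNReal.ofReal (a / x ^ p) = ENNReal.ofReal a * epow x (-p) := by
  rw [epow, ← ENNReal.ofReal_mul ha, Real.rpow_neg hx.le, div_eq_mul_inv]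

lemma setLIntegral_Ioo_sub_left (f : ℝ → ℝ≥0∞) (a b c : ℝ) :
    ∫⁻ s in Ioo a b, f (c - s) = ∫⁻ x in Ioo (c - b) (c - a), f x := by
  have h := (Measure.measurePreserving_sub_left (volume : Measure ℝ) c).setLIntegral_comp_preimage_emb
    (MeasurableEquiv.subLeft c).measurableEmbedding f (Ioo (c - b) (c - a))
  rw [← h]
  simp

lemma setLIntegral_Ioo_sub_right (f : ℝ → ℝ≥0∞) (a b c : ℝ) :
    ∫⁻ s in Ioo a b, f (s - c) = ∫⁻ x in Ioo (a - c) (b - c), f x := by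
  have h := (measurePreserving_sub_right (volume : Measure ℝ) c).setLIntegral_comp_preimage_emb
    (MeasurableEquiv.subRight c).measurableEmbedding f (Ioo (a - c) (b - c))
  rw [← h]
  simp

lemma setLIntegral_epow_zero {c p : ℝ} (hc : 0 ≤ c) (hp : p < 1) :
    ∫⁻ x in Ioo 0 c, epow x (-p) = ENNReal.ofReal (1 - p)⁻¹ * epow c (1 - p) := by
  have hi : IntervalIntegrable (fun x : ℝ => x ^ (-p)) volume 0 c :=
    intervalIntegral.intervalIntegrable_rpow' (by linarith)
  unfold epow
  rw [restrict_Ioo_eq_restrict_Ioc, ← ofReal_integral_eq_lintegral_ofReal hi.1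
    ((ae_restrict_iff' measurableSet_Ioc).2 (ae_of_all _ fun x hx => Real.rpow_nonneg hx.1.le _)),
    ← intervalIntegral.integral_of_le hc, integral_rpow (Or.inl (by linarith)),
    ← ENNReal.ofReal_mul (inv_nonneg.2 (by linarith)), Real.zero_rpow (by linarith)]
  congr 1
  rw [neg_add_eq_sub]
  field_simp
  ring

lemma setLIntegral_epow_sub_left {a b p : ℝ} (hab : a ≤ b) (hp : p < 1) :
    ∫⁻ s in Ioo a b, epow (b - s) (-p) = ENNReal.ofReal (1 - p)⁻¹ * epow (b - a) (1 - p) := by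
  rw [setLIntegral_Ioo_sub_left (fun x => epow x (-p)), sub_self,
    setLIntegral_epow_zero (by linarith) hp]

lemma setLIntegral_epow_sub_right {a b p : ℝ} (hab : a ≤ b) (hp : p < 1) :
    ∫⁻ s in Ioo a b, epow (s - a) (-p) = ENNReal.ofReal (1 - p)⁻¹ * epow (b - a) (1 - p) := by
  rw [setLIntegral_Ioo_sub_right (fun x => epow x (-p)), sub_self,
    setLIntegral_epow_zero (by linarith) hp]

lemma setLIntegral_epow_tail {a c γ : ℝ} (ha : 0 < a) (hγ : 0 < γ) :
    ∫⁻ x in Ioo a c, epow x (-(1 + γ)) ≤ ENNReal.ofReal γ⁻¹ * epow a (-γ) := by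
  rcases lt_or_ge c a with hac | hac
  · simp [Ioo_eq_empty (not_lt.2 hac.le)]
  have h0 : (0 : ℝ) ∉ uIcc a c := by
    rw [uIcc_of_le hac]; exact fun h => absurd h.1 (not_le.2 ha)
  have hi : IntervalIntegrable (fun x : ℝ => x ^ (-(1 + γ))) volume a c :=
    intervalIntegral.intervalIntegrable_rpow (Or.inr h0)
  unfold epow
  rw [restrict_Ioo_eq_restrict_Ioc, ← ofReal_integral_eq_lintegral_ofReal hi.1
    ((ae_restrict_iff' measurableSet_Ioc).2
      (ae_of_all _ fun x hx => Real.rpow_nonneg (ha.trans hx.1).le _)),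
    ← intervalIntegral.integral_of_le hac, integral_rpow (Or.inr ⟨by linarith, h0⟩),
    ← ENNReal.ofReal_mul (inv_nonneg.2 hγ.le)]
  apply ENNReal.ofReal_le_ofReal
  have hc : 0 ≤ c ^ (-γ) := Real.rpow_nonneg (ha.le.trans hac) _
  have : -(1 + γ) + 1 = -γ := by ring
  rw [this, div_neg, ← neg_div, div_eq_inv_mul]
  exact mul_le_mul_of_nonneg_left (by linarith) (inv_nonneg.2 hγ.le)

lemma setLIntegral_epow_tail_left {a b c γ : ℝ} (hbc : b < c) (hγ : 0 < γ) :
    ∫⁻ s in Ioo a b, epow (c - s) (-(1 + γ)) ≤ ENNReal.ofReal γ⁻¹ * epow (c - b) (-γ) := by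
  rw [setLIntegral_Ioo_sub_left (fun x => epow x (-(1 + γ)))]
  exact setLIntegral_epow_tail (by linarith) hγ

lemma setLIntegral_epow_tail_right {a b c γ : ℝ} (hca : c < a) (hγ : 0 < γ) :
    ∫⁻ s in Ioo a b, epow (s - c) (-(1 + γ)) ≤ ENNReal.ofReal γ⁻¹ * epow (a - c) (-γ) := by
  rw [setLIntegral_Ioo_sub_right (fun x => epow x (-(1 + γ)))]
  exact setLIntegral_epow_tail (by linarith) hγ

/-- A bound for the Beta integral `∫_0^1 (1-s)^{-p} s^{-q} ds`. -/
def betaBound (p q : ℝ) : ℝ≥0∞ :=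
  epow 2 p * ENNReal.ofReal (1 - q)⁻¹ + epow 2 q * ENNReal.ofReal (1 - p)⁻¹

lemma betaBound_ne_top (p q : ℝ) : betaBound p q ≠ ∞ := by
  unfold betaBound
  finiteness [epow_ne_top 2 p, epow_ne_top 2 q]

lemma epow_half {x : ℝ} (hx : 0 < x) (p : ℝ) : epow (x / 2) (-p) = epow 2 p * epow x (-p) := by
  rw [epow, epow, epow, ← ENNReal.ofReal_mul (by positivity), Real.div_rpow hx.le zero_le_two,
    Real.rpow_neg zero_le_two]
  field_simp

/-- At each point at least one of the two distances to the endpoints is at least (b-a)/2, so one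
factor can be frozen there and the other integrated over the whole interval. -/
lemma setLIntegral_beta_le {a b p q : ℝ} (hab : a < b) (hp : 0 ≤ p) (hp1 : p < 1) (hq : 0 ≤ q)
    (hq1 : q < 1) :
    ∫⁻ s in Ioo a b, epow (b - s) (-p) * epow (s - a) (-q) ≤
      betaBound p q * epow (b - a) (1 - p - q) := by
  have hba : 0 < b - a := sub_pos.2 hab
  calc ∫⁻ s in Ioo a b, epow (b - s) (-p) * epow (s - a) (-q)
    _ ≤ ∫⁻ s in Ioo a b, (epow ((b - a) / 2) (-p) * epow (s - a) (-q) +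
          epow ((b - a) / 2) (-q) * epow (b - s) (-p)) := by
        refine setLIntegral_mono (by fun_prop) fun s hs => ?_
        rcases le_total s ((a + b) / 2) with h | h
        · refine le_trans ?_ le_self_add
          gcongr
          exact epow_anti (by linarith) (by linarith) (by linarith)
        · refine le_trans ?_ le_add_self
          rw [mul_comm]
          gcongr
          exact epow_anti (by linarith) (by linarith) (by linarith)
    _ = _ := by
        rw [lintegral_add_left (by fun_prop), lintegral_const_mul _ (by fun_prop),
          lintegral_const_mul _ (by fun_prop), setLIntegral_epow_sub_left hab.le hp1,
          setLIntegral_epow_sub_right hab.le hq1, epow_half hba, epow_half hba, betaBound,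
          add_mul]
        have e1 : epow (b - a) (1 - p - q) = epow (b - a) (-p) * epow (b - a) (1 - q) := by
          rw [epow_mul_epow hba]; congr 1; ring
        have e2 : epow (b - a) (1 - p - q) = epow (b - a) (-q) * epow (b - a) (1 - p) := by
          rw [epow_mul_epow hba]; congr 1; ring
        congr 1
        · rw [e1]; ring
        · rw [e2]; ring

/-! ### A Gronwall inequality with a doubly singular kernel. -/

/-- The singular kernel `(t-u)^{-α} u^{-α}`. -/
def kernel (α t u : ℝ) : ℝ≥0∞ := epow (t - u) (-α) * epow u (-α)

@[fun_prop]
lemma measurable_kernel (α t : ℝ) : Measurable (kernel α t) := by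
  unfold kernel; fun_prop

lemma exp_neg_le_rpow {x p : ℝ} (hx : 0 < x) (hp : 0 ≤ p) (hp1 : p ≤ 1) :
    Real.exp (-x) ≤ x ^ (-p) := by
  rw [Real.exp_neg, Real.rpow_neg hx.le]
  apply inv_anti₀ (Real.rpow_pos_of_pos hx p)
  calc x ^ p ≤ (Real.exp x) ^ p :=
        Real.rpow_le_rpow hx.le ((lt_add_one x).le.trans (Real.add_one_le_exp x)) hp
    _ = Real.exp (x * p) := (Real.exp_mul x p).symm
    _ ≤ Real.exp x := Real.exp_le_exp.2 (by nlinarith)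

/-- The exponential is traded for (l(t-u))^(-p). The choice p = (1-2α)/2 raises the singularity at u
= t from α to exactly 1/2, which is still integrable, and leaves the factor l^(-p), small for large
l. -/
lemma lintegral_kernel_exp_le {α t l : ℝ} (hα : 0 < α) (hα' : α < 1 / 2) (ht : 0 < t)
    (hl : 0 < l) :
    ∫⁻ u in Ioo 0 t, kernel α t u * ENNReal.ofReal (Real.exp (-(l * (t - u)))) ≤
      epow l (-((1 - 2 * α) / 2)) * (betaBound (1 / 2) α * epow t ((1 - 2 * α) / 2)) := by
  set p := (1 - 2 * α) / 2 with hp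
  calc _ ≤ ∫⁻ u in Ioo 0 t, epow l (-p) * (epow (t - u) (-(1 / 2)) * epow (u - 0) (-α)) := by
        refine setLIntegral_mono (by fun_prop) fun u hu => ?_
        have htu : 0 < t - u := sub_pos.2 hu.2
        have h1 : ENNReal.ofReal (Real.exp (-(l * (t - u)))) ≤ epow l (-p) * epow (t - u) (-p) := by
          rw [epow, epow, ← ENNReal.ofReal_mul (by positivity), ← Real.mul_rpow hl.le htu.le]
          exact ENNReal.ofReal_le_ofReal
            (exp_neg_le_rpow (by positivity) (by linarith) (by linarith))
        calc _ ≤ kernel α t u * (epow l (-p) * epow (t - u) (-p)) := by gcongr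
          _ = epow l (-p) * ((epow (t - u) (-α) * epow (t - u) (-p)) * epow u (-α)) := by
            rw [kernel]; ring
          _ = _ := by
            rw [epow_mul_epow htu, sub_zero]; congr 4; rw [hp]; ring
    _ ≤ _ := by
        rw [lintegral_const_mul _ (by fun_prop)]
        gcongr
        refine (setLIntegral_beta_le ht (by norm_num) (by norm_num) hα.le (by linarith)).trans
          (le_of_eq ?_)
        rw [sub_zero]; congr 2; rw [hp]; ring

lemma exists_lintegral_kernel_exp_le {α T : ℝ} (hα : 0 < α) (hα' : α < 1 / 2)
    {C : ℝ≥0∞} (hC : C ≠ ∞) :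
    ∃ l : ℝ, 0 < l ∧ ∀ t ∈ Ioc 0 T,
      C * ∫⁻ u in Ioo 0 t, kernel α t u * ENNReal.ofReal (Real.exp (-(l * (t - u)))) ≤ 1 / 2 := by
  set p := (1 - 2 * α) / 2 with hp
  have hp0 : 0 < p := by rw [hp]; linarith
  set B := C * (betaBound (1 / 2) α * epow T p) with hB
  have hBt : B ≠ ∞ := ENNReal.mul_ne_top hC
    (ENNReal.mul_ne_top (betaBound_ne_top _ _) (epow_ne_top _ _))
  have hlim : Tendsto (fun l : ℝ => B * epow l (-p)) atTop (𝓝 0) := by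
    have h1 : Tendsto (fun l : ℝ => epow l (-p)) atTop (𝓝 0) := by
      have := ENNReal.tendsto_ofReal (tendsto_rpow_neg_atTop hp0)
      simpa [epow] using this
    simpa using ENNReal.Tendsto.const_mul h1 (Or.inr hBt)
  obtain ⟨l, hl, hl0⟩ := ((hlim.eventually (ge_mem_nhds (show (0 : ℝ≥0∞) < 1 / 2 by simp))).and
    (eventually_gt_atTop (0 : ℝ))).exists
  refine ⟨l, hl0, fun t ht => le_trans ?_ hl⟩
  calc _ ≤ C * (epow l (-p) * (betaBound (1 / 2) α * epow t p)) := by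
        gcongr
        exact lintegral_kernel_exp_le hα hα' ht.1 hl0
    _ ≤ C * (epow l (-p) * (betaBound (1 / 2) α * epow T p)) := by
        gcongr
        exact epow_mono ht.1.le ht.2 hp0.le
    _ = _ := by rw [hB]; ring

/-- A Gronwall inequality for the singular kernel `(t-u)^{-α} u^{-α}`. -/
lemma gronwall_kernel {α T : ℝ} (hα : 0 < α) (hα' : α < 1 / 2) {C : ℝ≥0∞} (hC : C ≠ ∞) :
    ∃ K : ℝ≥0∞, K ≠ ∞ ∧ ∀ (φ : ℝ → ℝ≥0∞) (a : ℝ≥0∞), (⨆ t ∈ Icc 0 T, φ t) ≠ ∞ →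
      (∀ t ∈ Icc 0 T, φ t ≤ a + C * ∫⁻ u in Ioo 0 t, kernel α t u * ⨆ v ∈ Icc 0 u, φ v) →
      ∀ t ∈ Icc 0 T, φ t ≤ K * a := by
  obtain ⟨l, hl, hker⟩ := exists_lintegral_kernel_exp_le (T := T) hα hα' hC
  set e : ℝ → ℝ≥0∞ := fun t => ENNReal.ofReal (Real.exp t) with he
  have hem : Measurable e := Real.measurable_exp.ennreal_ofReal
  have hemono : ∀ {s t : ℝ}, s ≤ t → e s ≤ e t := fun h =>
    ENNReal.ofReal_le_ofReal (Real.exp_le_exp.2 h)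
  have hemul : ∀ s t : ℝ, e s * e t = e (s + t) := fun s t => by
    simp only [he]; rw [← ENNReal.ofReal_mul (Real.exp_nonneg _), Real.exp_add]
  have he0 : e 0 = 1 := by simp [he]
  refine ⟨e (l * T) * 2, ENNReal.mul_ne_top ENNReal.ofReal_ne_top (by simp), ?_⟩
  intro φ a hφ h
  -- In this weighted supremum the integral operator has norm at most 1/2, because e^(-lt) e^(lu) =
  -- e^(-l(t-u)) and l was chosen for this kernel.
  set S := ⨆ t ∈ Icc 0 T, e (-(l * t)) * φ t with hS
  have hφS : ∀ t ∈ Icc 0 T, φ t ≤ e (l * t) * S := fun t ht => by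
    calc φ t = e (l * t) * (e (-(l * t)) * φ t) := by
          rw [← mul_assoc, hemul, add_neg_cancel, he0, one_mul]
      _ ≤ _ := by
          gcongr
          exact le_iSup₂ (f := fun t (_ : t ∈ Icc 0 T) => e (-(l * t)) * φ t) t ht
  -- Finiteness is what allows S/2 to be cancelled from both sides below; it is the only use of the
  -- a priori bound on φ.
  have hSfin : S ≠ ∞ := by
    refine ne_top_of_le_ne_top hφ (iSup₂_mono fun t ht => ?_)
    calc e (-(l * t)) * φ t ≤ e 0 * φ t := by
          gcongr
          exact hemono (by nlinarith [ht.1])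
      _ = φ t := by rw [he0, one_mul]
  have hSle : S ≤ a + S / 2 := by
    refine iSup₂_le fun t ht => ?_
    have h2 : ∫⁻ u in Ioo 0 t, kernel α t u * ⨆ v ∈ Icc 0 u, φ v ≤
        e (l * t) * ((∫⁻ u in Ioo 0 t, kernel α t u * e (-(l * (t - u)))) * S) := by
      -- Neither φ nor its running supremum is assumed measurable: the comparison of integrals needs
      -- measurability only of the majorant.
      rw [← lintegral_mul_const _ (by fun_prop), ← lintegral_const_mul _ (by fun_prop)]
      refine setLIntegral_mono (by fun_prop) fun u hu => ?_
      have h3 : ⨆ v ∈ Icc 0 u, φ v ≤ e (l * u) * S := iSup₂_le fun v hv =>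
        (hφS v ⟨hv.1, hv.2.trans (hu.2.le.trans ht.2)⟩).trans (by
          gcongr
          exact hemono (by nlinarith [hv.2]))
      calc _ ≤ kernel α t u * (e (l * u) * S) := by gcongr
        _ = kernel α t u * ((e (l * t) * e (-(l * (t - u)))) * S) := by
          rw [hemul]; congr 3; ring_nf
        _ = _ := by ring
    have hkt : C * ∫⁻ u in Ioo 0 t, kernel α t u * e (-(l * (t - u))) ≤ 1 / 2 := by
      rcases ht.1.eq_or_lt with h0 | h0
      · simp [← h0]
      · exact hker t ⟨h0, ht.2⟩
    calc e (-(l * t)) * φ t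
      _ ≤ e (-(l * t)) * (a + C * (e (l * t) *
            ((∫⁻ u in Ioo 0 t, kernel α t u * e (-(l * (t - u)))) * S))) := by
          gcongr
          exact (h t ht).trans (by gcongr)
      _ = e (-(l * t)) * a + (e (-(l * t)) * e (l * t)) *
            ((C * ∫⁻ u in Ioo 0 t, kernel α t u * e (-(l * (t - u)))) * S) := by ring
      _ ≤ e 0 * a + e 0 * (1 / 2 * S) := by
          rw [hemul, neg_add_cancel]
          gcongr
          exact hemono (by nlinarith [ht.1])
      _ = a + S / 2 := by
          rw [he0, one_mul, one_mul, one_div, mul_comm, div_eq_mul_inv]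
  have hS2 : S ≤ 2 * a := by
    have h1 : S / 2 + S / 2 ≤ a + S / 2 := by rw [ENNReal.add_halves]; exact hSle
    have h2 : S / 2 ≤ a :=
      (ENNReal.add_le_add_iff_right (ENNReal.div_ne_top hSfin (by simp))).1 h1
    calc S = S / 2 + S / 2 := (ENNReal.add_halves S).symm
      _ ≤ a + a := add_le_add h2 h2
      _ = 2 * a := (two_mul a).symm
  intro t ht
  calc φ t ≤ e (l * t) * S := hφS t ht
    _ ≤ e (l * T) * (2 * a) := by
      gcongr
      exact hemono (by nlinarith [ht.2])
    _ = _ := by ring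

/-! ### Integrals over triangles and measurability on an interval. -/

lemma measurable_setLIntegral_Ioo {f : ℝ → ℝ → ℝ≥0∞} (hf : Measurable (Function.uncurry f))
    {l r : ℝ → ℝ} (hl : Measurable l) (hr : Measurable r) :
    Measurable fun s => ∫⁻ u in Ioo (l s) (r s), f s u := by
  have hset : MeasurableSet {p : ℝ × ℝ | l p.1 < p.2 ∧ p.2 < r p.1} :=
    (measurableSet_lt (hl.comp measurable_fst) measurable_snd).inter
      (measurableSet_lt measurable_snd (hr.comp measurable_fst))
  have := Measurable.lintegral_prod_right' (ν := volume) (hf.indicator hset)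
  convert this using 2 with s
  rw [← lintegral_indicator measurableSet_Ioo]
  rfl

lemma setLIntegral_Ioo_swap {f : ℝ → ℝ → ℝ≥0∞} (hf : Measurable (Function.uncurry f)) (a t : ℝ) :
    ∫⁻ s in Ioo a t, ∫⁻ u in Ioo s t, f s u = ∫⁻ u in Ioo a t, ∫⁻ s in Ioo a u, f s u := by
  have hset : MeasurableSet {p : ℝ × ℝ | a < p.1 ∧ p.1 < p.2 ∧ p.2 < t} := by measurability
  have e : ∀ s u, (Ioo a t).indicator (fun s => (Ioo s t).indicator (f s) u) s =
      {p : ℝ × ℝ | a < p.1 ∧ p.1 < p.2 ∧ p.2 < t}.indicator (Function.uncurry f) (s, u) := by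
    intro s u
    simp only [indicator, mem_Ioo, mem_ofPred_eq, Function.uncurry]
    grind
  have e' : ∀ s u, (Ioo a t).indicator (fun u => (Ioo a u).indicator (fun s => f s u) s) u =
      {p : ℝ × ℝ | a < p.1 ∧ p.1 < p.2 ∧ p.2 < t}.indicator (Function.uncurry f) (s, u) := by
    intro s u
    simp only [indicator, mem_Ioo, mem_ofPred_eq, Function.uncurry]
    grind
  have l1 : ∫⁻ s in Ioo a t, ∫⁻ u in Ioo s t, f s u = ∫⁻ s, ∫⁻ u,
      {p : ℝ × ℝ | a < p.1 ∧ p.1 < p.2 ∧ p.2 < t}.indicator (Function.uncurry f) (s, u) := by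
    rw [← lintegral_indicator measurableSet_Ioo]
    refine lintegral_congr fun s => ?_
    simp_rw [← e]
    by_cases hs : s ∈ Ioo a t
    · simp only [indicator_of_mem hs]; rw [lintegral_indicator measurableSet_Ioo]
    · simp [indicator_of_notMem hs]
  have l2 : ∫⁻ u in Ioo a t, ∫⁻ s in Ioo a u, f s u = ∫⁻ u, ∫⁻ s,
      {p : ℝ × ℝ | a < p.1 ∧ p.1 < p.2 ∧ p.2 < t}.indicator (Function.uncurry f) (s, u) := by
    rw [← lintegral_indicator measurableSet_Ioo]
    refine lintegral_congr fun u => ?_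
    simp_rw [← e']
    by_cases hu : u ∈ Ioo a t
    · simp only [indicator_of_mem hu]; rw [lintegral_indicator measurableSet_Ioo]
    · simp [indicator_of_notMem hu]
  rw [l1, l2, lintegral_lintegral_swap]
  exact (hf.indicator hset).aemeasurable

/-- Measurability is given only on an interval, while parameter integrals and Tonelli are applied on
the line; the zero extension bridges the two. -/
lemma MeasOn.indicator {E : Type*} [MeasurableSpace E] [Zero E] {a b : ℝ} {f : ℝ → E}
    (hf : MeasOn a b f) : Measurable ((Icc a b).indicator f) := by
  refine measurable_of_restrict_of_restrict_compl (measurableSet_Icc (a := a) (b := b)) ?_ ?_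
  · refine (congrArg Measurable (funext fun t => ?_)).mpr hf
    exact indicator_of_mem t.2 f
  · refine (congrArg Measurable (funext fun t => ?_)).mpr (measurable_const (a := (0 : E)))
    exact indicator_of_notMem t.2 f

lemma MeasOn.congr {E : Type*} [MeasurableSpace E] {a b : ℝ} {f f' : ℝ → E}
    (hf : MeasOn a b f) (h : ∀ t ∈ Icc a b, f t = f' t) : MeasOn a b f' := by
  have : (fun t : Icc a b => f' t) = fun t : Icc a b => f t := funext fun t => (h t t.2).symm
  rw [MeasOn, this]; exact hf

lemma Measurable.measOn {E : Type*} [MeasurableSpace E] {f : ℝ → E} (hf : Measurable f)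
    (a b : ℝ) : MeasOn a b f := hf.comp measurable_subtype_coe

/-! ### From increment bounds to W-norm and Hölder bounds. -/

/-- The increments of `h` are controlled by a Hölder term and by singular integrals of `Ψ`. -/
def IncrementBound {E : Type*} [NormedAddCommGroup E] (α T : ℝ) (c C : ℝ≥0∞) (Ψ : ℝ → ℝ≥0∞)
    (h : ℝ → E) : Prop :=
  ∀ s t, 0 ≤ s → s < t → t ≤ T → ENNReal.ofReal ‖h t - h s‖ ≤ c * epow (t - s) (1 - α) +
    C * ((∫⁻ u in Ioo s t, epow u (-α) * Ψ u) + epow (t - s) (1 - α) *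
      ∫⁻ u in Ioo 0 s, epow (s - u) (-(1 - α)) * epow u (-α) * Ψ u)

lemma IncrementBound.congr {E : Type*} [NormedAddCommGroup E] {α T : ℝ} {c C : ℝ≥0∞}
    {Ψ Ψ' : ℝ → ℝ≥0∞} {h : ℝ → E} (hh : IncrementBound α T c C Ψ h)
    (hΨ : ∀ u ∈ Icc 0 T, Ψ u = Ψ' u) : IncrementBound α T c C Ψ' h := by
  intro s t hs hst ht
  have h1 : ∫⁻ u in Ioo s t, epow u (-α) * Ψ' u = ∫⁻ u in Ioo s t, epow u (-α) * Ψ u :=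
    setLIntegral_congr_fun measurableSet_Ioo fun u hu => by
      rw [hΨ u ⟨hs.trans hu.1.le, hu.2.le.trans ht⟩]
  have h2 : ∫⁻ u in Ioo 0 s, epow (s - u) (-(1 - α)) * epow u (-α) * Ψ' u =
      ∫⁻ u in Ioo 0 s, epow (s - u) (-(1 - α)) * epow u (-α) * Ψ u :=
    setLIntegral_congr_fun measurableSet_Ioo fun u hu => by
      rw [hΨ u ⟨hu.1.le, hu.2.le.trans (hst.le.trans ht)⟩]
  rw [h1, h2]
  exact hh s t hs hst ht

/-- After exchanging the integrals, the inner one is a Beta integral over (u,t) with exponents 2α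
and 1-α. Its homogeneity 1 - 2α - (1-α) = -α produces exactly the kernel. -/
lemma lintegral_epow_beta_le {α : ℝ} (hα : 0 < α) (hα' : α < 1 / 2) {Ψ : ℝ → ℝ≥0∞}
    (hΨ : Measurable Ψ) (t : ℝ) :
    ∫⁻ s in Ioo 0 t, ∫⁻ u in Ioo 0 s, epow (t - s) (-(2 * α)) *
        (epow (s - u) (-(1 - α)) * epow u (-α) * Ψ u) ≤
      betaBound (2 * α) (1 - α) * ∫⁻ u in Ioo 0 t, kernel α t u * Ψ u := by
  have m2 : Measurable (Function.uncurry fun u s : ℝ =>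
      epow (t - s) (-(2 * α)) * (epow (s - u) (-(1 - α)) * epow u (-α) * Ψ u)) := by
    unfold Function.uncurry; fun_prop
  rw [← setLIntegral_Ioo_swap m2, ← lintegral_const_mul _ (by fun_prop)]
  refine setLIntegral_mono (by fun_prop) fun u hu => ?_
  calc _ = ∫⁻ s in Ioo u t, (epow (t - s) (-(2 * α)) * epow (s - u) (-(1 - α))) *
        (epow u (-α) * Ψ u) := lintegral_congr fun s => by ring
    _ ≤ betaBound (2 * α) (1 - α) * epow (t - u) (1 - 2 * α - (1 - α)) *
        (epow u (-α) * Ψ u) := by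
        rw [lintegral_mul_const _ (by fun_prop)]
        gcongr
        exact setLIntegral_beta_le hu.2 (by linarith) (by linarith) (by linarith) (by linarith)
    _ = _ := by
        have : 1 - 2 * α - (1 - α) = -α := by ring
        rw [kernel, this]; ring

/-- Divide the increment bound by (t-s)^(α+1). The Hölder term becomes (t-s)^(-2α), integrable since
α < 1/2. In the first singular term, integrating (t-s)^(-1-α) over s < u leaves (t-u)^(-α)/α; the
second is `lintegral_epow_beta_le`. Both end in the same kernel. -/
lemma IncrementBound.lintegral_le {E : Type*} [NormedAddCommGroup E] {α T : ℝ} (hα : 0 < α)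
    (hα' : α < 1 / 2) {c C : ℝ≥0∞} {Ψ : ℝ → ℝ≥0∞} {h : ℝ → E} (hΨ : Measurable Ψ)
    (hh : IncrementBound α T c C Ψ h) {t : ℝ} (ht : t ∈ Ioc 0 T) :
    ∫⁻ s in Ioo 0 t, ENNReal.ofReal (‖h t - h s‖ / (t - s) ^ (α + 1)) ≤
      c * (ENNReal.ofReal (1 - 2 * α)⁻¹ * epow t (1 - 2 * α)) +
      C * ((ENNReal.ofReal α⁻¹ + betaBound (2 * α) (1 - α)) *
        ∫⁻ u in Ioo 0 t, kernel α t u * Ψ u) := by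
  have m1 : Measurable (Function.uncurry fun s u : ℝ =>
      epow (t - s) (-(1 + α)) * (epow u (-α) * Ψ u)) := by
    unfold Function.uncurry; fun_prop
  have m2 : Measurable (Function.uncurry fun u s : ℝ =>
      epow (t - s) (-(2 * α)) * (epow (s - u) (-(1 - α)) * epow u (-α) * Ψ u)) := by
    unfold Function.uncurry; fun_prop
  have m1' : Measurable fun s : ℝ => ∫⁻ u in Ioo s t, epow (t - s) (-(1 + α)) *
      (epow u (-α) * Ψ u) :=
    measurable_setLIntegral_Ioo m1 measurable_id measurable_const
  calc _ ≤ ∫⁻ s in Ioo 0 t, (c * epow (t - s) (-(2 * α)) +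
        (C * (∫⁻ u in Ioo s t, epow (t - s) (-(1 + α)) * (epow u (-α) * Ψ u)) +
        C * ∫⁻ u in Ioo 0 s, epow (t - s) (-(2 * α)) *
          (epow (s - u) (-(1 - α)) * epow u (-α) * Ψ u))) := by
        refine setLIntegral_mono' measurableSet_Ioo fun s hs => ?_
        have hts : 0 < t - s := sub_pos.2 hs.2
        rw [ofReal_div_rpow (norm_nonneg _) hts, lintegral_const_mul _ (by fun_prop),
          lintegral_const_mul _ (by fun_prop)]
        have e1 : epow (t - s) (-(2 * α)) = epow (t - s) (1 - α) * epow (t - s) (-(α + 1)) := by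
          rw [epow_mul_epow hts]; congr 1; ring
        rw [e1, add_comm 1 α]
        refine (mul_le_mul_left (hh s t hs.1.le hs.2 ht.2) _).trans (le_of_eq ?_)
        ring
    _ ≤ _ := by
        rw [lintegral_add_left (by fun_prop), lintegral_const_mul _ (by fun_prop),
          lintegral_add_left (by fun_prop), lintegral_const_mul _ m1',
          setLIntegral_epow_sub_left ht.1.le (by linarith), sub_zero]
        refine add_le_add le_rfl ?_
        rw [setLIntegral_Ioo_swap m1, add_mul, mul_add]
        refine add_le_add (mul_le_mul_right ?_ C) ?_
        · rw [← lintegral_const_mul _ (by fun_prop)]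
          refine setLIntegral_mono (by fun_prop) fun u hu => ?_
          rw [lintegral_mul_const _ (by fun_prop)]
          calc _ ≤ ENNReal.ofReal α⁻¹ * epow (t - u) (-α) * (epow u (-α) * Ψ u) := by
                gcongr
                exact setLIntegral_epow_tail_left hu.2 hα
            _ = _ := by rw [kernel]; ring
        · have m2' : Measurable fun s : ℝ => ∫⁻ u in Ioo 0 s, epow (t - s) (-(2 * α)) *
              (epow (s - u) (-(1 - α)) * epow u (-α) * Ψ u) :=
            measurable_setLIntegral_Ioo (f := fun s u => epow (t - s) (-(2 * α)) *
              (epow (s - u) (-(1 - α)) * epow u (-α) * Ψ u)) (m2.comp measurable_swap)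
              measurable_const measurable_id
          rw [lintegral_const_mul _ m2']
          gcongr
          exact lintegral_epow_beta_le hα hα' hΨ t

/-- With left endpoint 0 the second singular integral is empty, and t^(-α) ≤ (t-u)^(-α) turns the
first into the kernel integral. -/
lemma IncrementBound.sub_zero_le {E : Type*} [NormedAddCommGroup E] {α T : ℝ} (hα : 0 < α)
    {c C : ℝ≥0∞} {Ψ : ℝ → ℝ≥0∞} {h : ℝ → E} (hΨ : Measurable Ψ)
    (hh : IncrementBound α T c C Ψ h) {t : ℝ} (ht : t ∈ Ioc 0 T) :
    epow t (-α) * ENNReal.ofReal ‖h t - h 0‖ ≤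
      c * epow t (1 - 2 * α) + C * ∫⁻ u in Ioo 0 t, kernel α t u * Ψ u := by
  have h0 := hh 0 t le_rfl ht.1 ht.2
  rw [sub_zero, Ioo_self, Measure.restrict_empty, lintegral_zero_measure, mul_zero, add_zero] at h0
  calc _ ≤ epow t (-α) * (c * epow t (1 - α) + C * ∫⁻ u in Ioo 0 t, epow u (-α) * Ψ u) := by
        gcongr
    _ = c * (epow t (1 - α) * epow t (-α)) +
        C * ∫⁻ u in Ioo 0 t, epow t (-α) * (epow u (-α) * Ψ u) := by
        rw [lintegral_const_mul _ (by fun_prop)]; ring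
    _ ≤ _ := by
        rw [epow_mul_epow ht.1]
        have : 1 - α + -α = 1 - 2 * α := by ring
        rw [this]
        gcongr _ + C * ?_
        refine setLIntegral_mono (by fun_prop) fun u hu => ?_
        rw [kernel, mul_assoc]
        gcongr
        exact epow_anti (by linarith [hu.2]) (by linarith [hu.1]) (by linarith)

/-- The first and third terms on the left make up the W-norm on [0,t]. The term weighted by t^(-α)
is carried along because it is what a history interval before 0 contributes to the W-norm (see
`wPt_le_add`). -/
lemma IncrementBound.exists_le {E : Type*} [NormedAddCommGroup E] {α T : ℝ} (hα : 0 < α)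
    (hα' : α < 1 / 2) :
    ∃ K : ℝ≥0∞, K ≠ ∞ ∧ ∀ (c C : ℝ≥0∞) (Ψ : ℝ → ℝ≥0∞) (h : ℝ → E), MeasOn 0 T Ψ →
      IncrementBound α T c C Ψ h → ∀ t ∈ Ioc 0 T,
      ENNReal.ofReal ‖h t - h 0‖ + epow t (-α) * ENNReal.ofReal ‖h t - h 0‖ +
        ∫⁻ s in Ioo 0 t, ENNReal.ofReal (‖h t - h s‖ / (t - s) ^ (α + 1)) ≤
      K * (c + C * ∫⁻ u in Ioo 0 t, kernel α t u * Ψ u) := by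
  set A := epow T α + 1 with hA
  set B := ENNReal.ofReal (1 - 2 * α)⁻¹ with hB
  set D := ENNReal.ofReal α⁻¹ + betaBound (2 * α) (1 - α) with hD
  set Q := epow T (1 - 2 * α) with hQ
  have hAt : A ≠ ∞ := by finiteness [epow_ne_top T α]
  have hBt : B ≠ ∞ := ENNReal.ofReal_ne_top
  have hDt : D ≠ ∞ := by finiteness [betaBound_ne_top (2 * α) (1 - α)]
  have hQt : Q ≠ ∞ := epow_ne_top _ _
  refine ⟨A * Q + B * Q + (A + D), by finiteness, ?_⟩
  intro c C Ψ h hΨm hh t ht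
  have hΨ' : ∀ u ∈ Icc 0 T, Ψ u = (Icc 0 T).indicator Ψ u := fun u hu =>
    (indicator_of_mem hu Ψ).symm
  have hI : ∫⁻ u in Ioo 0 t, kernel α t u * Ψ u =
      ∫⁻ u in Ioo 0 t, kernel α t u * (Icc 0 T).indicator Ψ u :=
    setLIntegral_congr_fun measurableSet_Ioo fun u hu => by
      rw [hΨ' u ⟨hu.1.le, hu.2.le.trans ht.2⟩]
  have h1 := (hh.congr hΨ').lintegral_le hα hα' hΨm.indicator ht
  have h2 := (hh.congr hΨ').sub_zero_le hα hΨm.indicator ht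
  rw [← hI] at h1 h2
  set I := ∫⁻ u in Ioo 0 t, kernel α t u * Ψ u
  have hq : epow t (1 - 2 * α) ≤ Q := epow_mono ht.1.le ht.2 (by linarith)
  -- The unweighted term is absorbed into the weighted one through 1 = t^α t^(-α) ≤ T^α t^(-α).
  have h3 : ENNReal.ofReal ‖h t - h 0‖ ≤ epow T α * (epow t (-α) * ENNReal.ofReal ‖h t - h 0‖) := by
    calc _ = (epow t α * epow t (-α)) * ENNReal.ofReal ‖h t - h 0‖ := by
          rw [epow_mul_neg ht.1, one_mul]
      _ ≤ (epow T α * epow t (-α)) * ENNReal.ofReal ‖h t - h 0‖ := by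
          gcongr
          exact epow_mono ht.1.le ht.2 hα.le
      _ = _ := by ring
  calc _ ≤ epow T α * (epow t (-α) * ENNReal.ofReal ‖h t - h 0‖) +
        epow t (-α) * ENNReal.ofReal ‖h t - h 0‖ +
        (c * (B * epow t (1 - 2 * α)) + C * (D * I)) := by gcongr
    _ = A * (epow t (-α) * ENNReal.ofReal ‖h t - h 0‖) +
        (c * (B * epow t (1 - 2 * α)) + C * (D * I)) := by rw [hA]; ring
    _ ≤ A * (c * Q + C * I) + (c * (B * Q) + C * (D * I)) := by
        gcongr
        exact h2.trans (by gcongr)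
    _ = (A * Q + B * Q) * c + (A + D) * (C * I) := by ring
    _ ≤ (A * Q + B * Q + (A + D)) * c + (A * Q + B * Q + (A + D)) * (C * I) := by
        exact add_le_add (mul_le_mul_left le_self_add _) (mul_le_mul_left le_add_self _)
    _ = _ := by ring

/-- For bounded Ψ, the Beta integral with exponents 1-α and α has homogeneity 0, so the second term
is a constant times (t-s)^(1-α) uniformly in s. In the first, u^(-α) ≤ (u-s)^(-α). -/
lemma IncrementBound.holder {E : Type*} [NormedAddCommGroup E] {α T : ℝ} (hα : 0 < α)
    (hα' : α < 1 / 2) {c C S : ℝ≥0∞} {Ψ : ℝ → ℝ≥0∞} {h : ℝ → E}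
    (hh : IncrementBound α T c C Ψ h) (hS : ∀ u ∈ Icc 0 T, Ψ u ≤ S) {s t : ℝ} (hs : 0 ≤ s)
    (hst : s < t) (ht : t ≤ T) :
    ENNReal.ofReal ‖h t - h s‖ ≤
      (c + C * ((ENNReal.ofReal (1 - α)⁻¹ + betaBound (1 - α) α) * S)) * epow (t - s) (1 - α) := by
  refine (hh s t hs hst ht).trans ?_
  have h1 : ∫⁻ u in Ioo s t, epow u (-α) * Ψ u ≤
      ENNReal.ofReal (1 - α)⁻¹ * epow (t - s) (1 - α) * S := by
    rw [← setLIntegral_epow_sub_right hst.le (by linarith), ← lintegral_mul_const _ (by fun_prop)]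
    refine setLIntegral_mono (by fun_prop) fun u hu => ?_
    gcongr
    · exact epow_anti (by linarith [hu.1]) (by linarith) (by linarith)
    · exact hS u ⟨hs.trans hu.1.le, hu.2.le.trans ht⟩
  have h2 : ∫⁻ u in Ioo 0 s, epow (s - u) (-(1 - α)) * epow u (-α) * Ψ u ≤
      betaBound (1 - α) α * S := by
    rcases hs.eq_or_lt with h0 | h0
    · simp [← h0]
    have := setLIntegral_beta_le h0 (p := 1 - α) (q := α) (by linarith) (by linarith) hα.le
      (by linarith)
    have e0 : 1 - (1 - α) - α = 0 := by ring
    rw [e0, epow_zero, mul_one] at this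
    refine le_trans ?_ (mul_le_mul_left this S)
    rw [← lintegral_mul_const _ (by fun_prop)]
    refine setLIntegral_mono (by fun_prop) fun u hu => ?_
    rw [sub_zero]
    gcongr
    exact hS u ⟨hu.1.le, hu.2.le.trans (hst.le.trans ht)⟩
  calc _ ≤ c * epow (t - s) (1 - α) + C * (ENNReal.ofReal (1 - α)⁻¹ * epow (t - s) (1 - α) * S +
        epow (t - s) (1 - α) * (betaBound (1 - α) α * S)) := by gcongr
    _ = _ := by ring

/-! ### Integrators and their right-sided Weyl derivatives. -/

lemma measurable_intervalIntegral {f : ℝ → ℝ → ℝ} (hf : Measurable (Function.uncurry f))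
    {l r : ℝ → ℝ} (hl : Measurable l) (hr : Measurable r) :
    Measurable fun s => ∫ u in l s..r s, f s u := by
  have key : ∀ {l r : ℝ → ℝ}, Measurable l → Measurable r →
      Measurable fun s => ∫ u in Ioc (l s) (r s), f s u := by
    intro l r hl hr
    have hset : MeasurableSet {p : ℝ × ℝ | l p.1 < p.2 ∧ p.2 ≤ r p.1} :=
      (measurableSet_lt (hl.comp measurable_fst) measurable_snd).inter
        (measurableSet_le measurable_snd (hr.comp measurable_fst))
    have := (StronglyMeasurable.integral_prod_right' (ν := volume)
      (hf.indicator hset).stronglyMeasurable).measurable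
    convert this using 2 with s
    rw [← integral_indicator measurableSet_Ioc]
    rfl
  exact (key hl hr).sub (key hr hl)

lemma ofReal_norm_intervalIntegral_le {E : Type*} [NormedAddCommGroup E] [NormedSpace ℝ E]
    {a b : ℝ} (hab : a ≤ b) (f : ℝ → E) :
    ENNReal.ofReal ‖∫ u in a..b, f u‖ ≤ ∫⁻ u in Ioo a b, ENNReal.ofReal ‖f u‖ := by
  rw [intervalIntegral.integral_of_le hab, ofReal_norm, restrict_Ioo_eq_restrict_Ioc]
  simp_rw [ofReal_norm]
  exact enorm_integral_le_lintegral_enorm _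

lemma intervalIntegrable_of_lintegral {E : Type*} [NormedAddCommGroup E] {a b : ℝ} (hab : a ≤ b)
    {f : ℝ → E} (hf : AEStronglyMeasurable f (volume.restrict (Ioo a b)))
    (h : ∫⁻ u in Ioo a b, ENNReal.ofReal ‖f u‖ ≠ ∞) : IntervalIntegrable f volume a b := by
  rw [intervalIntegrable_iff_integrableOn_Ioo_of_le hab]
  refine ⟨hf, ?_⟩
  rw [hasFiniteIntegral_iff_enorm]
  simp_rw [ofReal_norm] at h
  exact h.lt_top

lemma MeasOn.aestronglyMeasurable {a b a' b' : ℝ} {f : ℝ → ℝ} (hf : MeasOn a b f)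
    (ha : a ≤ a') (hb : b' ≤ b) : AEStronglyMeasurable f (volume.restrict (Ioo a' b')) := by
  refine hf.indicator.aestronglyMeasurable.congr ?_
  refine (ae_restrict_iff' measurableSet_Ioo).2 (ae_of_all _ fun u hu => ?_)
  exact indicator_of_mem (show u ∈ Icc a b from ⟨ha.trans hu.1.le, hu.2.le.trans hb⟩) f

/-- A real integrator in `W_T^{1-α,∞}(0,T)` with norm at most `Λ`. -/
structure IsIntegrator (α T Λ : ℝ) (g : ℝ → ℝ) : Prop where
  nonneg : 0 ≤ Λ
  measOn : MeasOn 0 T g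
  holder : ∀ s t, 0 < s → s < t → t < T → |g t - g s| ≤ Λ * (t - s) ^ (1 - α)
  lintegral : ∀ s, 0 < s → s < T →
    ∫⁻ u in Ioo s T, ENNReal.ofReal (|g u - g s| / (u - s) ^ (2 - α)) ≤ ENNReal.ofReal Λ

namespace IsIntegrator

variable {α T Λ : ℝ} {g : ℝ → ℝ}

lemma tendsto_modulus (hα : α < 1) (t : ℝ) :
    Tendsto (fun u => Λ * (t - u) ^ (1 - α)) (𝓝[<] t) (𝓝 0) := by
  have hc : ContinuousAt (fun u => Λ * (t - u) ^ (1 - α)) t :=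
    continuousAt_const.mul ((continuousAt_const.sub continuousAt_id).rpow_const
      (Or.inr (by linarith)))
  have := hc.tendsto
  simp only [sub_self, Real.zero_rpow (by linarith : 1 - α ≠ 0), mul_zero] at this
  exact this.mono_left nhdsWithin_le_nhds

/-- The modulus of continuity holds only strictly inside (0,T), yet it makes the left filter at t
Cauchy. The case t = T is included, where g itself may jump. -/
lemma exists_tendsto (hg : IsIntegrator α T Λ g) (hα : α < 1) {t : ℝ} (ht : 0 < t) (htT : t ≤ T) :
    ∃ y, Tendsto g (𝓝[<] t) (𝓝 y) := by
  have hcau : Cauchy (map g (𝓝[<] t)) := by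
    rw [Metric.cauchy_iff]
    refine ⟨inferInstance, fun ε hε => ?_⟩
    have h1 := ((tendsto_modulus (Λ := Λ) hα t).eventually (gt_mem_nhds hε)).and
      (Ioo_mem_nhdsLT ht)
    obtain ⟨a, ha, hsub⟩ := (mem_nhdsLT_iff_exists_Ico_subset).1 h1
    have hat : a ∈ Ico a t := ⟨le_rfl, ha⟩
    refine ⟨g '' Ico a t, image_mem_map (Ico_mem_nhdsLT ha), ?_⟩
    have key : ∀ u ∈ Ico a t, ∀ v ∈ Ico a t, u < v → |g v - g u| < ε := fun u hu v hv huv =>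
      (hg.holder u v (hsub hu).2.1 huv (hv.2.trans_le htT)).trans_lt
        (lt_of_le_of_lt (mul_le_mul_of_nonneg_left (Real.rpow_le_rpow (by linarith)
          (by linarith [hv.2]) (by linarith)) hg.nonneg) (hsub hu).1)
    rintro _ ⟨u, hu, rfl⟩ _ ⟨v, hv, rfl⟩
    rw [Real.dist_eq]
    rcases lt_trichotomy u v with h | h | h
    · rw [abs_sub_comm]; exact key u hu v hv h
    · rw [h, sub_self, abs_zero]; exact hε
    · exact key v hv u hu h
  obtain ⟨y, hy⟩ := cauchy_iff_exists_le_nhds.1 hcau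
  exact ⟨y, hy⟩

lemma abs_sub_leftLim_le (hg : IsIntegrator α T Λ g) (hα : α < 1) {u t : ℝ} (hu : 0 < u)
    (hut : u < t) (htT : t ≤ T) : |g u - Function.leftLim g t| ≤ Λ * (t - u) ^ (1 - α) := by
  have h1 := tendsto_leftLim_of_tendsto (hg.exists_tendsto hα (hu.trans hut) htT)
  refine le_of_tendsto ((tendsto_const_nhds (x := g u)).sub h1).abs ?_
  filter_upwards [Ioo_mem_nhdsLT hut] with v hv
  rw [abs_sub_comm]
  exact (hg.holder u v hu hv.1 (hv.2.trans_le htT)).trans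
    (mul_le_mul_of_nonneg_left (Real.rpow_le_rpow (by linarith [hv.1]) (by linarith [hv.2])
      (by linarith)) hg.nonneg)

lemma leftLim_eq (hg : IsIntegrator α T Λ g) (hα : α < 1) {s : ℝ} (hs : 0 < s)
    (hsT : s < T) : Function.leftLim g s = g s := by
  apply leftLim_eq_of_tendsto
  rw [tendsto_iff_dist_tendsto_zero]
  refine squeeze_zero' (Eventually.of_forall fun _ => dist_nonneg) ?_ (tendsto_modulus (Λ := Λ) hα s)
  filter_upwards [Ioo_mem_nhdsLT hs] with u hu
  rw [dist_comm, Real.dist_eq]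
  exact hg.holder u s hu.1 hu.2 hsT

lemma intervalIntegrable (hg : IsIntegrator α T Λ g) {u t : ℝ} (hu : 0 < u) (hut : u ≤ t)
    (huT : u < T) (htT : t ≤ T) :
    IntervalIntegrable (fun y => (g u - g y) / (y - u) ^ (1 - α + 1)) volume u t := by
  refine intervalIntegrable_of_lintegral hut ?_ (ne_top_of_le_ne_top ENNReal.ofReal_ne_top
    (le_trans ?_ (hg.lintegral u hu huT)))
  · exact (aestronglyMeasurable_const.sub (hg.measOn.aestronglyMeasurable hu.le htT)).div₀
      (by fun_prop : Measurable fun y : ℝ => (y - u) ^ (1 - α + 1)).aestronglyMeasurable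
  · refine (lintegral_mono_set (Ioo_subset_Ioo_right htT)).trans
      (setLIntegral_mono' measurableSet_Ioo fun y hy => le_of_eq ?_)
    rw [Real.norm_eq_abs, abs_div, abs_sub_comm,
      abs_of_nonneg (Real.rpow_nonneg (sub_nonneg.2 hy.1.le) _)]
    congr 3; ring

/-- A bound for the right-sided Weyl derivatives of an integrator. -/
def weylBound (α Λ : ℝ) : ℝ≥0∞ := ENNReal.ofReal (Real.Gamma α)⁻¹ * (ENNReal.ofReal Λ * 2)

lemma weylBound_ne_top (α Λ : ℝ) : weylBound α Λ ≠ ∞ := by unfold weylBound; finiteness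

lemma weylRight_eq (α t : ℝ) (g : ℝ → ℝ) (c u : ℝ) :
    weylRight (1 - α) t (fun v => g v - c) u = (Real.Gamma α)⁻¹ *
      ((g u - c) / (t - u) ^ (1 - α) +
        (1 - α) * ∫ y in u..t, (g u - g y) / (y - u) ^ (1 - α + 1)) := by
  simp [weylRight]

/-- The norm of g matches the two terms of the derivative: its Hölder part, passed to the left
limit, bounds the boundary term, and its integral part bounds the singular integral. -/
lemma ofReal_abs_weylRight_le (hg : IsIntegrator α T Λ g) (hα : 0 < α) (hα' : α < 1) {u t : ℝ}
    (hu : 0 < u) (hut : u < t) (htT : t ≤ T) :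
    ENNReal.ofReal |weylRight (1 - α) t (fun v => g v - Function.leftLim g t) u| ≤
      weylBound α Λ := by
  have hΓ : 0 < Real.Gamma α := Real.Gamma_pos_of_pos hα
  rw [weylRight_eq, abs_mul, abs_of_pos (inv_pos.2 hΓ), ENNReal.ofReal_mul (inv_pos.2 hΓ).le,
    weylBound]
  gcongr
  refine (ENNReal.ofReal_le_ofReal (abs_add_le _ _)).trans ?_
  rw [ENNReal.ofReal_add (abs_nonneg _) (abs_nonneg _), mul_two]
  refine add_le_add (ENNReal.ofReal_le_ofReal ?_) ?_
  · rw [abs_div, abs_of_pos (Real.rpow_pos_of_pos (sub_pos.2 hut) _),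
      div_le_iff₀ (Real.rpow_pos_of_pos (sub_pos.2 hut) _)]
    exact hg.abs_sub_leftLim_le hα' hu hut htT
  · rw [abs_mul, abs_of_pos (sub_pos.2 hα'), ENNReal.ofReal_mul (sub_pos.2 hα').le]
    refine (mul_le_of_le_one_left zero_le (ENNReal.ofReal_le_one.2 (by linarith))).trans ?_
    refine (ofReal_norm_intervalIntegral_le (E := ℝ) hut.le _).trans ?_
    refine le_trans ?_ (hg.lintegral u hu (hut.trans_le htT))
    refine (lintegral_mono_set (Ioo_subset_Ioo_right htT)).trans
      (setLIntegral_mono' measurableSet_Ioo fun y hy => le_of_eq ?_)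
    rw [Real.norm_eq_abs, abs_div, abs_sub_comm,
      abs_of_nonneg (Real.rpow_nonneg (sub_nonneg.2 hy.1.le) _)]
    congr 3; ring

lemma integral_rpow_tail {α u s t : ℝ} (hα : α < 1) (hus : u < s) (hst : s ≤ t) :
    (1 - α) * ∫ y in s..t, (y - u) ^ (-(1 - α + 1)) =
      ((s - u) ^ (1 - α))⁻¹ - ((t - u) ^ (1 - α))⁻¹ := by
  have h0 : (0 : ℝ) ∉ uIcc (s - u) (t - u) := by
    rw [uIcc_of_le (by linarith)]; exact fun h => absurd h.1 (by linarith)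
  have h1 : 1 - α ≠ 0 := by linarith
  rw [intervalIntegral.integral_comp_sub_right (fun y => y ^ (-(1 - α + 1))) u,
    integral_rpow (Or.inr ⟨by intro h; apply h1; linarith, h0⟩)]
  have : -(1 - α + 1) + 1 = -(1 - α) := by ring
  rw [this, Real.rpow_neg (by linarith), Real.rpow_neg (by linarith)]
  field_simp
  ring

/-- The effect of moving the endpoint of a right-sided Weyl derivative. -/
lemma weylRight_sub (hg : IsIntegrator α T Λ g) (hα' : α < 1) {u s t : ℝ}
    (hu : 0 < u) (hus : u < s) (hst : s < t) (htT : t ≤ T) :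
    weylRight (1 - α) t (fun v => g v - Function.leftLim g t) u -
      weylRight (1 - α) s (fun v => g v - Function.leftLim g s) u =
    (Real.Gamma α)⁻¹ * ((g s - Function.leftLim g t) / (t - u) ^ (1 - α) +
      (1 - α) * ∫ y in s..t, (g s - g y) / (y - u) ^ (1 - α + 1)) := by
  have hs : 0 < s := hu.trans hus
  have hsT : s < T := hst.trans_le htT
  have huT : u < T := hus.trans hsT
  rw [weylRight_eq, weylRight_eq, hg.leftLim_eq hα' hs hsT, ← mul_sub]
  congr 1
  have i1 := hg.intervalIntegrable hu (hus.trans hst).le huT htT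
  have i2 := hg.intervalIntegrable hu hus.le huT hsT.le
  have i3 := (i2.symm.trans i1)
  have h1 := intervalIntegral.integral_interval_sub_left i1 i2
  have i4 : IntervalIntegrable (fun y => (y - u) ^ (-(1 - α + 1))) volume s t := by
    apply ContinuousOn.intervalIntegrable
    rw [uIcc_of_le hst.le]
    refine ContinuousOn.rpow_const (by fun_prop) fun y hy => Or.inl ?_
    have := hy.1; intro h; linarith
  -- Writing g(u) - g(y) = (g(u) - g(s)) + (g(s) - g(y)), the constant part integrates explicitly by
  -- `integral_rpow_tail` and cancels against the boundary terms, so that only increments of g from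
  -- s onwards survive.
  have h2 : ∫ y in s..t, (g s - g y) / (y - u) ^ (1 - α + 1) =
      (∫ y in s..t, (g u - g y) / (y - u) ^ (1 - α + 1)) -
        (g u - g s) * ∫ y in s..t, (y - u) ^ (-(1 - α + 1)) := by
    rw [← intervalIntegral.integral_const_mul, ← intervalIntegral.integral_sub i3 (i4.const_mul _)]
    refine intervalIntegral.integral_congr fun y hy => ?_
    rw [uIcc_of_le hst.le] at hy
    rw [Real.rpow_neg (by linarith [hy.1])]
    field_simp
    ring
  have h3 := integral_rpow_tail hα' hus hst.le
  rw [h2, ← h1]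
  linear_combination (g u - g s) * h3

/-- By `weylRight_sub` only increments of g over [s,t] enter, each at most Λ(t-s)^(1-α). The
remaining weights contribute (s-u)^(-(1-α)), since t-u ≥ s-u and (y-u)^(-(2-α)) has that tail
integral up to the factor 1/(1-α), which the prefactor cancels. -/
lemma ofReal_abs_weylRight_sub_le (hg : IsIntegrator α T Λ g) (hα : 0 < α) (hα' : α < 1)
    {u s t : ℝ} (hu : 0 < u) (hus : u < s) (hst : s < t) (htT : t ≤ T) :
    ENNReal.ofReal |weylRight (1 - α) t (fun v => g v - Function.leftLim g t) u -
      weylRight (1 - α) s (fun v => g v - Function.leftLim g s) u| ≤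
    weylBound α Λ * (epow (t - s) (1 - α) * epow (s - u) (-(1 - α))) := by
  have hΓ : 0 < Real.Gamma α := Real.Gamma_pos_of_pos hα
  have hs : 0 < s := hu.trans hus
  have h1α : 0 < 1 - α := sub_pos.2 hα'
  rw [hg.weylRight_sub hα' hu hus hst htT, abs_mul, abs_of_pos (inv_pos.2 hΓ),
    ENNReal.ofReal_mul (inv_pos.2 hΓ).le, weylBound, mul_assoc]
  gcongr
  refine (ENNReal.ofReal_le_ofReal (abs_add_le _ _)).trans ?_
  rw [ENNReal.ofReal_add (abs_nonneg _) (abs_nonneg _), mul_two, add_mul]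
  have hΛ : ∀ {a}, ENNReal.ofReal (Λ * a ^ (1 - α)) = ENNReal.ofReal Λ * epow a (1 - α) := by
    intro a; rw [epow, ENNReal.ofReal_mul hg.nonneg]
  refine add_le_add ?_ ?_
  · rw [abs_div, abs_of_pos (Real.rpow_pos_of_pos (sub_pos.2 (hus.trans hst)) _),
      ofReal_div_rpow (abs_nonneg _) (sub_pos.2 (hus.trans hst)), ← mul_assoc, ← hΛ]
    gcongr
    · exact hg.abs_sub_leftLim_le hα' hs hst htT
    · exact epow_anti (sub_pos.2 hus) (by linarith) (by linarith)
  · rw [abs_mul, abs_of_pos h1α, ENNReal.ofReal_mul h1α.le]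
    calc _ ≤ ENNReal.ofReal (1 - α) * ∫⁻ y in Ioo s t,
          (ENNReal.ofReal (Λ * (t - s) ^ (1 - α)) * epow (y - u) (-(1 + (1 - α)))) := by
          gcongr
          refine (ofReal_norm_intervalIntegral_le (E := ℝ) hst.le _).trans
            (setLIntegral_mono' measurableSet_Ioo fun y hy => ?_)
          have hyu : 0 < y - u := by linarith [hy.1]
          rw [Real.norm_eq_abs, abs_div, abs_of_pos (Real.rpow_pos_of_pos hyu _),
            ofReal_div_rpow (abs_nonneg _) hyu, add_comm 1 (1 - α), abs_sub_comm]
          gcongr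
          exact (hg.holder s y hs hy.1 (hy.2.trans_le htT)).trans
            (mul_le_mul_of_nonneg_left (Real.rpow_le_rpow (by linarith [hy.1])
              (by linarith [hy.2]) h1α.le) hg.nonneg)
      _ ≤ ENNReal.ofReal (1 - α) * (ENNReal.ofReal (Λ * (t - s) ^ (1 - α)) *
          (ENNReal.ofReal (1 - α)⁻¹ * epow (s - u) (-(1 - α)))) := by
          rw [lintegral_const_mul _ (by fun_prop)]
          gcongr
          exact setLIntegral_epow_tail_right hus h1α
      _ = (ENNReal.ofReal (1 - α) * ENNReal.ofReal (1 - α)⁻¹) * (ENNReal.ofReal Λ *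
          (epow (t - s) (1 - α) * epow (s - u) (-(1 - α)))) := by
          rw [hΛ]; ring
      _ = _ := by
          rw [← ENNReal.ofReal_mul h1α.le, mul_inv_cancel₀ h1α.ne', ENNReal.ofReal_one, one_mul]

lemma aestronglyMeasurable_weylRight (hg : IsIntegrator α T Λ g) (γ c : ℝ) {t : ℝ} (htT : t ≤ T) :
    AEStronglyMeasurable (weylRight γ t (fun v => g v - c)) (volume.restrict (Ioo 0 t)) := by
  set g' := (Icc 0 T).indicator g with hg'
  have hm : Measurable g' := hg.measOn.indicator
  have hint : Measurable fun x => ∫ y in x..t, (g' x - g' y) / (y - x) ^ (γ + 1) :=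
    measurable_intervalIntegral (f := fun x y => (g' x - g' y) / (y - x) ^ (γ + 1))
      (by unfold Function.uncurry; fun_prop) measurable_id measurable_const
  have hw : Measurable (fun x => (Real.Gamma (1 - γ))⁻¹ * ((g' x - c) / (t - x) ^ γ +
      γ * ∫ y in x..t, (g' x - g' y) / (y - x) ^ (γ + 1))) := by fun_prop
  refine hw.aestronglyMeasurable.congr ?_
  refine (ae_restrict_iff' measurableSet_Ioo).2 (ae_of_all _ fun x hx => ?_)
  have hx' : g' x = g x := indicator_of_mem
    (show x ∈ Icc 0 T from ⟨hx.1.le, hx.2.le.trans htT⟩) g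
  simp only [weylRight, sub_sub_sub_cancel_right, hx']
  congr 3
  refine intervalIntegral.integral_congr fun y hy => ?_
  rw [uIcc_of_le hx.2.le] at hy
  have hy' : g' y = g y := indicator_of_mem
    (show y ∈ Icc 0 T from ⟨hx.1.le.trans hy.1, hy.2.trans htT⟩) g
  simp only [hy']

end IsIntegrator

/-! ### Left-sided Weyl derivatives and increments of the Stieltjes integral. -/

/-- The expression `|f(t)| + ∫_a^t |f(t)-f(s)| / (t-s)^{α+1} ds` whose supremum is `wNorm`. -/
def wPt {E : Type*} [NormedAddCommGroup E] (α a : ℝ) (f : ℝ → E) (t : ℝ) : ℝ≥0∞ :=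
  ENNReal.ofReal ‖f t‖ + ∫⁻ s in Ioo a t, ENNReal.ofReal (‖f t - f s‖ / (t - s) ^ (α + 1))

section wPt

variable {E : Type*} [NormedAddCommGroup E]

lemma wPt_le_wNorm {α a b : ℝ} (f : ℝ → E) {t : ℝ} (ht : t ∈ Icc a b) :
    wPt α a f t ≤ wNorm α a b f :=
  le_iSup₂ (f := fun t (_ : t ∈ Icc a b) => wPt α a f t) t ht

lemma wPt_congr {α a t : ℝ} {f f' : ℝ → E} (hat : a ≤ t) (h : ∀ s ∈ Icc a t, f s = f' s) :
    wPt α a f t = wPt α a f' t := by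
  rw [wPt, wPt, h t ⟨hat, le_rfl⟩]
  congr 1
  exact setLIntegral_congr_fun measurableSet_Ioo fun s hs => by rw [h s ⟨hs.1.le, hs.2.le⟩]

lemma wPt_mono {F : Type*} [NormedAddCommGroup F] {α a t : ℝ} {f : ℝ → E} {f' : ℝ → F}
    (h : ‖f t‖ ≤ ‖f' t‖) (h' : ∀ s, ‖f t - f s‖ ≤ ‖f' t - f' s‖) :
    wPt α a f t ≤ wPt α a f' t := by
  refine add_le_add (ENNReal.ofReal_le_ofReal h)
    (setLIntegral_mono' measurableSet_Ioo fun s hs => ENNReal.ofReal_le_ofReal ?_)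
  exact div_le_div_of_nonneg_right (h' s) (Real.rpow_nonneg (sub_nonneg.2 hs.2.le) _)

variable [MeasurableSpace E] [BorelSpace E] [SecondCountableTopology E]

lemma measurable_wPt (α a : ℝ) {f : ℝ → E} (hf : Measurable f) : Measurable (wPt α a f) := by
  refine hf.norm.ennreal_ofReal.add (measurable_setLIntegral_Ioo
    (f := fun t s => ENNReal.ofReal (‖f t - f s‖ / (t - s) ^ (α + 1))) ?_ measurable_const
    measurable_id)
  unfold Function.uncurry
  fun_prop

lemma MeasOn.wPt (α : ℝ) {a b : ℝ} {f : ℝ → E} (hf : MeasOn a b f) : MeasOn a b (wPt α a f) := by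
  refine MeasOn.congr (Measurable.measOn (measurable_wPt α a hf.indicator) a b) fun t ht => ?_
  exact wPt_congr ht.1 fun s hs => indicator_of_mem (show s ∈ Icc a b from ⟨hs.1, hs.2.trans ht.2⟩) f

end wPt

/-- The constant in the bound of left-sided Weyl derivatives. -/
def leftBound (α T : ℝ) : ℝ≥0∞ := ENNReal.ofReal (Real.Gamma (1 - α))⁻¹ * (1 + epow T α)

lemma leftBound_ne_top (α T : ℝ) : leftBound α T ≠ ∞ := by
  unfold leftBound; finiteness [epow_ne_top T α]

lemma norm_div_rpow {x y p : ℝ} (hy : 0 ≤ y) : ‖x / y ^ p‖ = ‖x‖ / y ^ p := by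
  rw [norm_div, Real.norm_of_nonneg (Real.rpow_nonneg hy p)]

lemma ofReal_abs_weylLeft_le {α T u : ℝ} (hα : 0 < α) (hα' : α < 1) (f : ℝ → ℝ)
    (hu : u ∈ Ioc 0 T) :
    ENNReal.ofReal |weylLeft α 0 f u| ≤ leftBound α T * (epow u (-α) * wPt α 0 f u) := by
  have hΓ : 0 < (Real.Gamma (1 - α))⁻¹ := inv_pos.2 (Real.Gamma_pos_of_pos (by linarith))
  rw [weylLeft, abs_mul, abs_of_pos hΓ, ENNReal.ofReal_mul hΓ.le, leftBound, mul_assoc]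
  gcongr
  refine (ENNReal.ofReal_le_ofReal (abs_add_le _ _)).trans ?_
  rw [ENNReal.ofReal_add (abs_nonneg _) (abs_nonneg _), add_mul, one_mul, sub_zero]
  have h1 : ENNReal.ofReal |f u / u ^ α| = epow u (-α) * ENNReal.ofReal ‖f u‖ := by
    rw [← Real.norm_eq_abs, norm_div_rpow hu.1.le, ofReal_div_rpow (norm_nonneg _) hu.1, mul_comm]
  -- The singular integral carries no weight of its own; the common factor u^(-α) is inserted at the
  -- cost of T^α, which accounts for `1 + epow T α` in `leftBound`.
  have h2 : ENNReal.ofReal |α * ∫ y in (0 : ℝ)..u, (f u - f y) / (u - y) ^ (α + 1)| ≤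
      epow T α * (epow u (-α) *
        ∫⁻ s in Ioo 0 u, ENNReal.ofReal (‖f u - f s‖ / (u - s) ^ (α + 1))) := by
    rw [abs_mul, abs_of_pos hα, ENNReal.ofReal_mul hα.le]
    refine (mul_le_of_le_one_left zero_le (ENNReal.ofReal_le_one.2 hα'.le)).trans ?_
    refine (ofReal_norm_intervalIntegral_le (E := ℝ) hu.1.le _).trans ?_
    calc _ = (epow u α * epow u (-α)) *
          ∫⁻ s in Ioo 0 u, ENNReal.ofReal (‖f u - f s‖ / (u - s) ^ (α + 1)) := by
          rw [epow_mul_neg hu.1, one_mul]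
          exact setLIntegral_congr_fun measurableSet_Ioo fun s hs => by
            rw [norm_div_rpow (sub_nonneg.2 hs.2.le)]
      _ ≤ _ := by
          rw [← mul_assoc]
          gcongr
          exact epow_mono hu.1.le hu.2 hα.le
  rw [h1]
  refine add_le_add ?_ (h2.trans ?_)
  · gcongr; exact le_self_add
  · gcongr; exact le_add_self

lemma intervalIntegrable_weylLeft_kernel {α T u : ℝ} {f : ℝ → ℝ} (hf : MeasOn 0 T f)
    (hu : u ∈ Ioc 0 T) (hfin : wPt α 0 f u ≠ ∞) :
    IntervalIntegrable (fun y => (f u - f y) / (u - y) ^ (α + 1)) volume 0 u := by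
  refine intervalIntegrable_of_lintegral hu.1.le ?_ (ne_top_of_le_ne_top hfin (le_trans ?_
    (le_add_self (a := ∫⁻ s in Ioo 0 u, ENNReal.ofReal (‖f u - f s‖ / (u - s) ^ (α + 1))))))
  · exact (aestronglyMeasurable_const.sub (hf.aestronglyMeasurable le_rfl hu.2)).div₀
      (by fun_prop : Measurable fun y : ℝ => (u - y) ^ (α + 1)).aestronglyMeasurable
  · exact setLIntegral_mono' measurableSet_Ioo fun y hy => by
      rw [norm_div_rpow (sub_nonneg.2 hy.2.le)]

/-- The Bochner integral is additive only on integrable functions; finiteness of `wPt` at u is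
precisely integrability of the singular integrands. -/
lemma weylLeft_sub {α T u : ℝ} {f f' : ℝ → ℝ} (hf : MeasOn 0 T f) (hf' : MeasOn 0 T f')
    (hu : u ∈ Ioc 0 T) (hfin : wPt α 0 f u ≠ ∞) (hfin' : wPt α 0 f' u ≠ ∞) :
    weylLeft α 0 (fun s => f s - f' s) u = weylLeft α 0 f u - weylLeft α 0 f' u := by
  have h : ∫ y in (0 : ℝ)..u, ((f u - f' u) - (f y - f' y)) / (u - y) ^ (α + 1) =
      (∫ y in (0 : ℝ)..u, (f u - f y) / (u - y) ^ (α + 1)) -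
        ∫ y in (0 : ℝ)..u, (f' u - f' y) / (u - y) ^ (α + 1) := by
    rw [← intervalIntegral.integral_sub (intervalIntegrable_weylLeft_kernel hf hu hfin)
      (intervalIntegrable_weylLeft_kernel hf' hu hfin')]
    refine intervalIntegral.integral_congr fun y _ => ?_
    ring
  simp only [weylLeft]
  rw [h]
  ring

lemma aestronglyMeasurable_weylLeft {α T : ℝ} {f : ℝ → ℝ} (hf : MeasOn 0 T f) {t : ℝ}
    (ht : t ≤ T) : AEStronglyMeasurable (weylLeft α 0 f) (volume.restrict (Ioo 0 t)) := by
  set f' := (Icc 0 T).indicator f with hf'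
  have hm : Measurable f' := hf.indicator
  have hint : Measurable fun x => ∫ y in (0 : ℝ)..x, (f' x - f' y) / (x - y) ^ (α + 1) :=
    measurable_intervalIntegral (f := fun x y => (f' x - f' y) / (x - y) ^ (α + 1))
      (by unfold Function.uncurry; fun_prop) measurable_const measurable_id
  have hw : Measurable (weylLeft α 0 f') := by unfold weylLeft; fun_prop
  refine hw.aestronglyMeasurable.congr ?_
  refine (ae_restrict_iff' measurableSet_Ioo).2 (ae_of_all _ fun x hx => ?_)
  have hx' : f' x = f x := indicator_of_mem
    (show x ∈ Icc 0 T from ⟨hx.1.le, hx.2.le.trans ht⟩) f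
  simp only [weylLeft, hx']
  congr 3
  refine intervalIntegral.integral_congr fun y hy => ?_
  rw [uIcc_of_le hx.1.le] at hy
  have hy' : f' y = f y := indicator_of_mem
    (show y ∈ Icc 0 T from ⟨hy.1, hy.2.trans (hx.2.le.trans ht)⟩) f
  simp only [hy']

lemma intervalIntegrable_weylLeft {α T : ℝ} (hα : 0 < α) (hα' : α < 1) {f : ℝ → ℝ}
    (hf : MeasOn 0 T f) {S : ℝ≥0∞} (hS : S ≠ ∞) (hfS : ∀ u ∈ Icc 0 T, wPt α 0 f u ≤ S) {t : ℝ}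
    (ht : t ∈ Icc 0 T) : IntervalIntegrable (weylLeft α 0 f) volume 0 t := by
  refine intervalIntegrable_of_lintegral ht.1 (aestronglyMeasurable_weylLeft hf ht.2) ?_
  have hb : ∫⁻ u in Ioo 0 t, ENNReal.ofReal ‖weylLeft α 0 f u‖ ≤
      leftBound α T * ((ENNReal.ofReal (1 - α)⁻¹ * epow t (1 - α)) * S) := by
    rw [← setLIntegral_epow_zero ht.1 hα', ← lintegral_mul_const _ (by fun_prop),
      ← lintegral_const_mul _ (by fun_prop)]
    refine setLIntegral_mono (by fun_prop) fun u hu => ?_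
    refine (ofReal_abs_weylLeft_le hα hα' f ⟨hu.1, hu.2.le.trans ht.2⟩).trans ?_
    gcongr
    exact hfS u ⟨hu.1.le, hu.2.le.trans ht.2⟩
  refine ne_top_of_le_ne_top ?_ hb
  finiteness [leftBound_ne_top α T, epow_ne_top t (1 - α)]

lemma intervalIntegrable_stieltjes {α T Λ : ℝ} (hα : 0 < α) (hα' : α < 1) {f g : ℝ → ℝ}
    (hg : IsIntegrator α T Λ g) (hf : MeasOn 0 T f) {S : ℝ≥0∞} (hS : S ≠ ∞)
    (hfS : ∀ u ∈ Icc 0 T, wPt α 0 f u ≤ S) {t : ℝ} (ht : t ∈ Icc 0 T) :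
    IntervalIntegrable (fun x => weylLeft α 0 f x *
      weylRight (1 - α) t (fun u => g u - Function.leftLim g t) x) volume 0 t := by
  have h := intervalIntegrable_weylLeft hα hα' hf hS hfS ht
  rw [intervalIntegrable_iff_integrableOn_Ioo_of_le ht.1] at h ⊢
  refine h.mul_bdd (c := (IsIntegrator.weylBound α Λ).toReal)
    (hg.aestronglyMeasurable_weylRight _ _ ht.2) ?_
  refine (ae_restrict_iff' measurableSet_Ioo).2 (ae_of_all _ fun x hx => ?_)
  exact (ENNReal.ofReal_le_iff_le_toReal (IsIntegrator.weylBound_ne_top _ _)).1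
    (hg.ofReal_abs_weylRight_le hα hα' hx.1 hx.2 ht.2)

lemma stieltjes_sub {α T Λ : ℝ} (hα : 0 < α) (hα' : α < 1) {f f' g : ℝ → ℝ}
    (hg : IsIntegrator α T Λ g) (hf : MeasOn 0 T f) (hf' : MeasOn 0 T f') {S : ℝ≥0∞} (hS : S ≠ ∞)
    (hfS : ∀ u ∈ Icc 0 T, wPt α 0 f u ≤ S) (hfS' : ∀ u ∈ Icc 0 T, wPt α 0 f' u ≤ S) {t : ℝ}
    (ht : t ∈ Icc 0 T) :
    stieltjes α 0 t (fun s => f s - f' s) g = stieltjes α 0 t f g - stieltjes α 0 t f' g := by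
  simp only [stieltjes]
  rw [← neg_sub', ← intervalIntegral.integral_sub
    (intervalIntegrable_stieltjes hα hα' hg hf hS hfS ht)
    (intervalIntegrable_stieltjes hα hα' hg hf' hS hfS' ht),
    intervalIntegral.integral_of_le ht.1, intervalIntegral.integral_of_le ht.1]
  congr 1
  refine setIntegral_congr_fun measurableSet_Ioc fun u hu => ?_
  have hu' : u ∈ Icc 0 T := ⟨hu.1.le, hu.2.trans ht.2⟩
  rw [weylLeft_sub hf hf' ⟨hu.1, hu'.2⟩ (ne_top_of_le_ne_top hS (hfS u hu'))
    (ne_top_of_le_ne_top hS (hfS' u hu')), sub_mul]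

/-- The left derivative is based at 0 for both endpoints, so no additivity of the generalized
integral over adjacent intervals is needed: an increment is the integral of the left derivative
against the right derivative on (s,t), plus that against the change of the right derivative on
(0,s). The bound S serves only integrability and does not enter the constant. -/
lemma incrementBound_stieltjes {α T Λ : ℝ} (hα : 0 < α) (hα' : α < 1) {f g : ℝ → ℝ}
    (hg : IsIntegrator α T Λ g) (hf : MeasOn 0 T f) {S : ℝ≥0∞} (hS : S ≠ ∞)
    (hfS : ∀ u ∈ Icc 0 T, wPt α 0 f u ≤ S) :
    IncrementBound α T 0 (leftBound α T * IsIntegrator.weylBound α Λ) (wPt α 0 f)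
      (fun t => stieltjes α 0 t f g) := by
  intro s t hs hst htT
  have ht : t ∈ Icc 0 T := ⟨hs.trans hst.le, htT⟩
  have hs' : s ∈ Icc 0 T := ⟨hs, hst.le.trans htT⟩
  set C := leftBound α T
  set W := IsIntegrator.weylBound α Λ
  set L := weylLeft α 0 f with hL
  set R : ℝ → ℝ → ℝ := fun t => weylRight (1 - α) t (fun u => g u - Function.leftLim g t) with hR
  have it : IntervalIntegrable (fun x => L x * R t x) volume 0 t :=
    intervalIntegrable_stieltjes hα hα' hg hf hS hfS ht
  have is : IntervalIntegrable (fun x => L x * R s x) volume 0 s :=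
    intervalIntegrable_stieltjes hα hα' hg hf hS hfS hs'
  have it0 : IntervalIntegrable (fun x => L x * R t x) volume 0 s :=
    it.mono_set (by rw [uIcc_of_le hs, uIcc_of_le ht.1]; exact Icc_subset_Icc_right hst.le)
  have it1 : IntervalIntegrable (fun x => L x * R t x) volume s t := it0.symm.trans it
  have e : stieltjes α 0 t f g - stieltjes α 0 s f g =
      -((∫ x in s..t, L x * R t x) + ∫ x in (0 : ℝ)..s, L x * (R t x - R s x)) := by
    have h1 := intervalIntegral.integral_add_adjacent_intervals it0 it1
    have h2 : ∫ x in (0 : ℝ)..s, L x * (R t x - R s x) =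
        (∫ x in (0 : ℝ)..s, L x * R t x) - ∫ x in (0 : ℝ)..s, L x * R s x := by
      rw [← intervalIntegral.integral_sub it0 is]
      exact intervalIntegral.integral_congr fun x _ => mul_sub _ _ _
    simp only [stieltjes]
    rw [h2, ← h1]
    ring
  have hLu : ∀ u ∈ Ioo 0 t, ENNReal.ofReal ‖L u‖ ≤ C * (epow u (-α) * wPt α 0 f u) :=
    fun u hu => ofReal_abs_weylLeft_le hα hα' f ⟨hu.1, hu.2.le.trans htT⟩
  have b1 : ENNReal.ofReal ‖∫ x in s..t, L x * R t x‖ ≤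
      (C * W) * ∫⁻ u in Ioo s t, epow u (-α) * wPt α 0 f u := by
    rw [← lintegral_const_mul' _ _ (ENNReal.mul_ne_top (leftBound_ne_top _ _)
      (IsIntegrator.weylBound_ne_top _ _))]
    refine (ofReal_norm_intervalIntegral_le hst.le _).trans
      (setLIntegral_mono' measurableSet_Ioo fun u hu => ?_)
    have hu0 : 0 < u := hs.trans_lt hu.1
    rw [norm_mul, ENNReal.ofReal_mul (norm_nonneg _)]
    calc _ ≤ (C * (epow u (-α) * wPt α 0 f u)) * W :=
          mul_le_mul' (hLu u ⟨hu0, hu.2⟩) (hg.ofReal_abs_weylRight_le hα hα' hu0 hu.2 htT)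
      _ = _ := by ring
  have b2 : ENNReal.ofReal ‖∫ x in (0 : ℝ)..s, L x * (R t x - R s x)‖ ≤
      (C * W) * (epow (t - s) (1 - α) *
        ∫⁻ u in Ioo 0 s, epow (s - u) (-(1 - α)) * epow u (-α) * wPt α 0 f u) := by
    rw [← lintegral_const_mul' _ _ (epow_ne_top _ _),
      ← lintegral_const_mul' _ _ (ENNReal.mul_ne_top (leftBound_ne_top _ _)
      (IsIntegrator.weylBound_ne_top _ _))]
    refine (ofReal_norm_intervalIntegral_le hs _).trans
      (setLIntegral_mono' measurableSet_Ioo fun u hu => ?_)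
    rw [norm_mul, ENNReal.ofReal_mul (norm_nonneg _)]
    calc _ ≤ (C * (epow u (-α) * wPt α 0 f u)) *
          (W * (epow (t - s) (1 - α) * epow (s - u) (-(1 - α)))) :=
          mul_le_mul' (hLu u ⟨hu.1, hu.2.trans hst⟩)
            (hg.ofReal_abs_weylRight_sub_le hα hα' hu.1 hu.2 hst htT)
      _ = _ := by ring
  simp only
  rw [e, norm_neg, zero_mul, zero_add, mul_add]
  refine (ENNReal.ofReal_le_ofReal (norm_add_le _ _)).trans ?_
  rw [ENNReal.ofReal_add (norm_nonneg _) (norm_nonneg _)]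
  exact add_le_add b1 b2

/-! ### Vector-valued Stieltjes integrals. -/

lemma norm_le_sum_abs {ι : Type*} [Fintype ι] (v : EuclideanSpace ℝ ι) : ‖v‖ ≤ ∑ i, |v i| := by
  rw [EuclideanSpace.norm_eq]
  refine Real.sqrt_le_iff.2 ⟨Finset.sum_nonneg fun i _ => abs_nonneg _, ?_⟩
  exact Finset.sum_sq_le_sq_sum_of_nonneg fun i _ => norm_nonneg _

section vector

variable {d m : ℕ} {α T Λ : ℝ} {g : ℝ → EuclideanSpace ℝ (Fin m)}
  {A A' : ℝ → EuclideanSpace ℝ (Fin d × Fin m)}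

lemma MeasOn.apply {ι : Type*} [Fintype ι] {a b : ℝ} {A : ℝ → EuclideanSpace ℝ ι}
    (hA : MeasOn a b A) (i : ι) : MeasOn a b (fun s => A s i) :=
  (by fun_prop : Measurable fun v : EuclideanSpace ℝ ι => v i).comp hA

lemma wPt_apply_le {ι : Type*} [Fintype ι] (α a : ℝ) (A : ℝ → EuclideanSpace ℝ ι) (i : ι) (t : ℝ) :
    wPt α a (fun s => A s i) t ≤ wPt α a A t :=
  wPt_mono (PiLp.norm_apply_le (A t) i) fun s => PiLp.norm_apply_le (A t - A s) i

lemma vecStieltjes_sub (hα : 0 < α) (hα' : α < 1)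
    (hg : ∀ j, IsIntegrator α T Λ (fun s => g s j)) (hA : MeasOn 0 T A) (hA' : MeasOn 0 T A')
    {S : ℝ≥0∞} (hS : S ≠ ∞) (hAS : ∀ u ∈ Icc 0 T, wPt α 0 A u ≤ S)
    (hAS' : ∀ u ∈ Icc 0 T, wPt α 0 A' u ≤ S) {t : ℝ} (ht : t ∈ Icc 0 T) :
    vecStieltjes α t (fun s => A s - A' s) g = vecStieltjes α t A g - vecStieltjes α t A' g := by
  ext i
  simp only [vecStieltjes, PiLp.sub_apply, ← Finset.sum_sub_distrib]
  exact Finset.sum_congr rfl fun j _ => stieltjes_sub hα hα' (hg j) (hA.apply _) (hA'.apply _) hS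
    (fun u hu => (wPt_apply_le ..).trans (hAS u hu))
    (fun u hu => (wPt_apply_le ..).trans (hAS' u hu)) ht

lemma incrementBound_vecStieltjes (hα : 0 < α) (hα' : α < 1)
    (hg : ∀ j, IsIntegrator α T Λ (fun s => g s j)) (hA : MeasOn 0 T A) {S : ℝ≥0∞} (hS : S ≠ ∞)
    (hAS : ∀ u ∈ Icc 0 T, wPt α 0 A u ≤ S) :
    IncrementBound α T 0 (d * (m * (leftBound α T * IsIntegrator.weylBound α Λ))) (wPt α 0 A)
      (fun t => vecStieltjes α t A g) := by
  intro s t hs hst htT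
  simp only
  set B := leftBound α T * IsIntegrator.weylBound α Λ
  set Q := (∫⁻ u in Ioo s t, epow u (-α) * wPt α 0 A u) + epow (t - s) (1 - α) *
      ∫⁻ u in Ioo 0 s, epow (s - u) (-(1 - α)) * epow u (-α) * wPt α 0 A u with hQ
  have hij : ∀ i j, ENNReal.ofReal |stieltjes α 0 t (fun s => A s (i, j)) (fun s => g s j) -
      stieltjes α 0 s (fun s => A s (i, j)) (fun s => g s j)| ≤ B * Q := by
    intro i j
    have h := incrementBound_stieltjes hα hα' (hg j) (hA.apply (i, j)) hS
      (fun u hu => (wPt_apply_le ..).trans (hAS u hu)) s t hs hst htT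
    rw [zero_mul, zero_add] at h
    refine h.trans ?_
    rw [hQ]
    gcongr with u u
    · exact wPt_apply_le ..
    · exact wPt_apply_le ..
  rw [zero_mul, zero_add]
  calc _ ≤ ENNReal.ofReal (∑ i : Fin d, ∑ j : Fin m,
        |stieltjes α 0 t (fun s => A s (i, j)) (fun s => g s j) -
          stieltjes α 0 s (fun s => A s (i, j)) (fun s => g s j)|) := by
        refine ENNReal.ofReal_le_ofReal ((norm_le_sum_abs _).trans ?_)
        refine Finset.sum_le_sum fun i _ => ?_
        simp only [vecStieltjes, PiLp.sub_apply, ← Finset.sum_sub_distrib]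
        exact Finset.abs_sum_le_sum_abs _ _
    _ = ∑ i : Fin d, ∑ j : Fin m, ENNReal.ofReal
        |stieltjes α 0 t (fun s => A s (i, j)) (fun s => g s j) -
          stieltjes α 0 s (fun s => A s (i, j)) (fun s => g s j)| := by
        rw [ENNReal.ofReal_sum_of_nonneg fun i _ => Finset.sum_nonneg fun j _ => abs_nonneg _]
        exact Finset.sum_congr rfl fun i _ => ENNReal.ofReal_sum_of_nonneg fun j _ => abs_nonneg _
    _ ≤ ∑ i : Fin d, ∑ j : Fin m, B * Q :=
        Finset.sum_le_sum fun i _ => Finset.sum_le_sum fun j _ => hij i j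
    _ = _ := by
        simp only [Finset.sum_const, Finset.card_univ, Fintype.card_fin, nsmul_eq_mul]
        ring

end vector

lemma MemWT.exists_isIntegrator {m : ℕ} {α T : ℝ} {g : ℝ → EuclideanSpace ℝ (Fin m)}
    (hg : MemWT α T g) : ∃ Λ, ∀ j, IsIntegrator α T Λ (fun s => g s j) := by
  obtain ⟨hm, hfin⟩ := hg
  have hle : ∀ s t, 0 < s → s < t → t < T → ENNReal.ofReal (‖g t - g s‖ / (t - s) ^ (1 - α)) +
      ∫⁻ u in Ioo s t, ENNReal.ofReal (‖g u - g s‖ / (u - s) ^ (2 - α)) ≤ wTNorm α T g := by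
    intro s t hs hst ht
    refine le_trans ?_ (le_iSup₂ (f := fun s (_ : s ∈ Ioo 0 T) => ⨆ t ∈ Ioo s T,
      (ENNReal.ofReal (‖g t - g s‖ / (t - s) ^ (1 - α)) +
      ∫⁻ u in Ioo s t, ENNReal.ofReal (‖g u - g s‖ / (u - s) ^ (2 - α)))) s ⟨hs, hst.trans ht⟩)
    exact le_iSup₂ (f := fun t (_ : t ∈ Ioo s T) =>
      ENNReal.ofReal (‖g t - g s‖ / (t - s) ^ (1 - α)) +
      ∫⁻ u in Ioo s t, ENNReal.ofReal (‖g u - g s‖ / (u - s) ^ (2 - α))) t ⟨hst, ht⟩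
  refine ⟨(wTNorm α T g).toReal, fun j => ⟨ENNReal.toReal_nonneg, hm.apply j, ?_, ?_⟩⟩
  · intro s t hs hst ht
    rw [← div_le_iff₀ (Real.rpow_pos_of_pos (sub_pos.2 hst) _)]
    refine (ENNReal.ofReal_le_iff_le_toReal hfin.ne).1 (le_trans ?_ (hle s t hs hst ht))
    refine le_trans (ENNReal.ofReal_le_ofReal ?_) le_self_add
    gcongr
    exact PiLp.norm_apply_le (g t - g s) j
  · intro s hs hsT
    rw [ENNReal.ofReal_toReal hfin.ne]
    -- The norm of g only tests intervals ending strictly before T; the integral up to T follows by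
    -- exhausting (s,T) with an increasing sequence of endpoints.
    obtain ⟨v, hv, hvm, hvlim⟩ := exists_seq_strictMono_tendsto' hsT
    have hU : Ioo s T = ⋃ n, Ioo s (v n) := by
      ext u
      simp only [mem_iUnion, mem_Ioo]
      refine ⟨fun h => ?_, fun ⟨n, h⟩ => ⟨h.1, h.2.trans (hvm n).2⟩⟩
      obtain ⟨n, hn⟩ := (hvlim.eventually (lt_mem_nhds h.2)).exists
      exact ⟨n, h.1, hn⟩
    rw [hU, setLIntegral_iUnion_of_directed _ (directed_of_isDirected_le fun i j hij =>
      Ioo_subset_Ioo_right (hv.monotone hij))]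
    refine iSup_le fun n => le_trans ?_ (hle s (v n) hs (hvm n).1 (hvm n).2)
    refine le_trans ?_ le_add_self
    refine setLIntegral_mono' measurableSet_Ioo fun u hu => ENNReal.ofReal_le_ofReal ?_
    gcongr
    · exact Real.rpow_nonneg (sub_nonneg.2 hu.1.le) _
    · exact PiLp.norm_apply_le (g u - g s) j

/-! ### Regularity of the diffusion coefficient. -/

section coefficient

variable {d m : ℕ} {T β δ : ℝ}
  {σ : ℝ → EuclideanSpace ℝ (Fin d) → EuclideanSpace ℝ (Fin d × Fin m)}

lemma fderiv_apply_eq_sum (t : ℝ) (x v : EuclideanSpace ℝ (Fin d)) :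
    fderiv ℝ (σ t) x v = ∑ i, v i • partialX σ i t x := by
  have hv : v = ∑ i, v i • EuclideanSpace.single i (1 : ℝ) := by
    ext j
    simp [Pi.single_apply]
  conv_lhs => rw [hv]
  simp [map_sum, partialX]

lemma norm_fderiv_sub_apply_le {t s K : ℝ} {p q v : EuclideanSpace ℝ (Fin d)}
    (h : ∀ i, ‖partialX σ i t p - partialX σ i s q‖ ≤ K) :
    ‖fderiv ℝ (σ t) p v - fderiv ℝ (σ s) q v‖ ≤ d * K * ‖v‖ := by
  rw [fderiv_apply_eq_sum, fderiv_apply_eq_sum, ← Finset.sum_sub_distrib]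
  calc _ ≤ ∑ i : Fin d, ‖v i • partialX σ i t p - v i • partialX σ i s q‖ := norm_sum_le _ _
    _ ≤ ∑ i : Fin d, ‖v‖ * K := by
        refine Finset.sum_le_sum fun i _ => ?_
        rw [← smul_sub, norm_smul]
        exact mul_le_mul (PiLp.norm_apply_le v i) (h i) (norm_nonneg _) (norm_nonneg _)
    _ = _ := by
        simp only [Finset.sum_const, Finset.card_univ, Fintype.card_fin, nsmul_eq_mul]
        ring

/-- The second-order difference of a coefficient with Hölder derivative. -/
lemma norm_four_point_le {M MN N : ℝ} (hδ : 0 < δ) (hδ' : δ ≤ 1) (hM : 0 ≤ M) (hMN : 0 ≤ MN)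
    (hd : ∀ t ∈ Icc 0 T, Differentiable ℝ (σ t))
    (hlip : ∀ t ∈ Icc 0 T, ∀ x y, ‖σ t x - σ t y‖ ≤ M * ‖x - y‖)
    (hder : ∀ t ∈ Icc 0 T, ∀ x y, ‖x‖ ≤ N → ‖y‖ ≤ N → ∀ i,
      ‖partialX σ i t x - partialX σ i t y‖ ≤ MN * ‖x - y‖ ^ δ)
    (htime : ∀ t ∈ Icc 0 T, ∀ s ∈ Icc 0 T, ∀ x, ∀ i,
      ‖σ t x - σ s x‖ + ‖partialX σ i t x - partialX σ i s x‖ ≤ M * |t - s| ^ β)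
    {t s : ℝ} (ht : t ∈ Icc 0 T) (hs : s ∈ Icc 0 T) {x₁ x₂ y₁ y₂ : EuclideanSpace ℝ (Fin d)}
    (hx₁ : ‖x₁‖ ≤ N) (hx₂ : ‖x₂‖ ≤ N) (hy₁ : ‖y₁‖ ≤ N) (hy₂ : ‖y₂‖ ≤ N) :
    ‖(σ t x₁ - σ t y₁) - (σ s x₂ - σ s y₂)‖ ≤ M * ‖(x₁ - y₁) - (x₂ - y₂)‖ +
      d * (M * |t - s| ^ β + MN * (‖x₁ - x₂‖ ^ δ + ‖y₁ - y₂‖ ^ δ)) * ‖x₁ - y₁‖ := by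
  set p : ℝ → EuclideanSpace ℝ (Fin d) := fun θ => y₁ + θ • (x₁ - y₁) with hp
  set q : ℝ → EuclideanSpace ℝ (Fin d) := fun θ => y₂ + θ • (x₂ - y₂) with hq
  set C := M * ‖(x₁ - y₁) - (x₂ - y₂)‖ +
      d * (M * |t - s| ^ β + MN * (‖x₁ - x₂‖ ^ δ + ‖y₁ - y₂‖ ^ δ)) * ‖x₁ - y₁‖ with hC
  -- Balls are convex, so both segments stay where the local Hölder constant of the derivative
  -- applies.
  have hball : ∀ {x y : EuclideanSpace ℝ (Fin d)} {θ : ℝ}, ‖x‖ ≤ N → ‖y‖ ≤ N → θ ∈ Ico (0 : ℝ) 1 →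
      ‖y + θ • (x - y)‖ ≤ N := by
    intro x y θ hx hy hθ
    have : y + θ • (x - y) = (1 - θ) • y + θ • x := by module
    rw [this]
    refine (norm_add_le _ _).trans ?_
    rw [norm_smul, norm_smul, Real.norm_of_nonneg hθ.1, Real.norm_of_nonneg (by linarith [hθ.2])]
    nlinarith [hθ.1, hθ.2]
  have hpd : ∀ θ, HasDerivAt p (x₁ - y₁) θ := fun θ => by
    have h := ((hasDerivAt_id θ).smul_const (x₁ - y₁)).const_add y₁
    rwa [one_smul] at h
  have hqd : ∀ θ, HasDerivAt q (x₂ - y₂) θ := fun θ => by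
    have h := ((hasDerivAt_id θ).smul_const (x₂ - y₂)).const_add y₂
    rwa [one_smul] at h
  have hF : ∀ θ, HasDerivAt (fun θ => σ t (p θ) - σ s (q θ))
      (fderiv ℝ (σ t) (p θ) (x₁ - y₁) - fderiv ℝ (σ s) (q θ) (x₂ - y₂)) θ := fun θ =>
    ((hd t ht (p θ)).hasFDerivAt.comp_hasDerivAt θ (hpd θ)).sub
      ((hd s hs (q θ)).hasFDerivAt.comp_hasDerivAt θ (hqd θ))
  have hbound : ∀ θ ∈ Ico (0 : ℝ) 1,
      ‖fderiv ℝ (σ t) (p θ) (x₁ - y₁) - fderiv ℝ (σ s) (q θ) (x₂ - y₂)‖ ≤ C := by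
    intro θ hθ
    -- The change of direction is paid with the Lipschitz bound on σ, the change of base point and
    -- time with the regularity of the partial derivatives.
    have e : fderiv ℝ (σ t) (p θ) (x₁ - y₁) - fderiv ℝ (σ s) (q θ) (x₂ - y₂) =
        fderiv ℝ (σ s) (q θ) ((x₁ - y₁) - (x₂ - y₂)) +
        (fderiv ℝ (σ t) (p θ) (x₁ - y₁) - fderiv ℝ (σ s) (q θ) (x₁ - y₁)) := by
      rw [map_sub _ (x₁ - y₁) (x₂ - y₂)]; abel
    rw [e]
    refine (norm_add_le _ _).trans (add_le_add ?_ (norm_fderiv_sub_apply_le fun i => ?_))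
    · refine (ContinuousLinearMap.le_opNorm _ _).trans
        (mul_le_mul_of_nonneg_right ?_ (norm_nonneg _))
      refine norm_fderiv_le_of_lipschitz ℝ (C := ⟨M, hM⟩) (LipschitzWith.of_dist_le_mul fun a b => ?_)
      rw [dist_eq_norm, dist_eq_norm]
      exact hlip s hs a b
    · have hpN : ‖p θ‖ ≤ N := hball hx₁ hy₁ hθ
      have hqN : ‖q θ‖ ≤ N := hball hx₂ hy₂ hθ
      have hpq : ‖p θ - q θ‖ ≤ ‖x₁ - x₂‖ + ‖y₁ - y₂‖ := by
        have : p θ - q θ = (1 - θ) • (y₁ - y₂) + θ • (x₁ - x₂) := by simp only [hp, hq]; module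
        rw [this]
        refine (norm_add_le _ _).trans ?_
        rw [norm_smul, norm_smul, Real.norm_of_nonneg hθ.1,
          Real.norm_of_nonneg (by linarith [hθ.2])]
        nlinarith [hθ.1, hθ.2, norm_nonneg (x₁ - x₂), norm_nonneg (y₁ - y₂)]
      calc _ ≤ ‖partialX σ i t (p θ) - partialX σ i s (p θ)‖ +
            ‖partialX σ i s (p θ) - partialX σ i s (q θ)‖ := norm_sub_le_norm_sub_add_norm_sub ..
        _ ≤ _ := by
            refine add_le_add ?_ ((hder s hs _ _ hpN hqN i).trans ?_)
            · exact le_trans (le_add_of_nonneg_left (norm_nonneg _)) (htime t ht s hs (p θ) i)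
            · gcongr
              exact (Real.rpow_le_rpow (norm_nonneg _) hpq hδ.le).trans
                (Real.rpow_add_le_add_rpow (norm_nonneg _) (norm_nonneg _) hδ.le hδ')
  have key := norm_image_sub_le_of_norm_deriv_le_segment_01'
    (fun θ _ => (hF θ).hasDerivWithinAt) hbound
  simp only [hp, hq, one_smul, zero_smul, add_zero, add_sub_cancel] at key
  rwa [sub_sub_sub_comm] at key

/-- Lipschitz and time regularity of the coefficient, with linear growth. -/
lemma HypH1.exists_lipschitz (hσ : HypH1 T β δ σ) :
    ∃ M, 0 ≤ M ∧ (∀ t ∈ Icc 0 T, ∀ x y, ‖σ t x - σ t y‖ ≤ M * ‖x - y‖) ∧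
      (∀ t ∈ Icc 0 T, ∀ s ∈ Icc 0 T, ∀ x, ‖σ t x - σ s x‖ ≤ M * |t - s| ^ β) := by
  obtain ⟨-, -, M, hM, hlip, -, htime⟩ := hσ
  refine ⟨M 0, (hM 0 le_rfl).le, hlip, fun t ht s hs x => ?_⟩
  -- The time-regularity hypothesis is quantified over a coordinate index, hence empty for d = 0; in
  -- that case the values of σ live in a trivial space.
  rcases isEmpty_or_nonempty (Fin d) with hd | ⟨⟨i⟩⟩
  · rw [Subsingleton.elim (σ t x) (σ s x), sub_self, norm_zero]
    exact mul_nonneg (hM 0 le_rfl).le (Real.rpow_nonneg (abs_nonneg _) _)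
  · exact (le_add_of_nonneg_right (norm_nonneg _)).trans (htime t ht s hs x i)

lemma HypH1.measOn_comp (hσ : HypH1 T β δ σ) {y : ℝ → EuclideanSpace ℝ (Fin d)}
    (hy : MeasOn 0 T y) : MeasOn 0 T (fun s => σ s (y s)) :=
  hσ.1.comp (measurable_id.prodMk hy)

end coefficient

/-! ### W-norms of composed functions and the delay error. -/

lemma setLIntegral_epow_holder {a u κ α : ℝ} (hau : a ≤ u) (hκ : α < κ) :
    ∫⁻ s in Ioo a u, epow (u - s) κ * epow (u - s) (-(α + 1)) =
      ENNReal.ofReal (κ - α)⁻¹ * epow (u - a) (κ - α) := by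
  have := setLIntegral_epow_sub_left hau (p := 1 - (κ - α)) (by linarith)
  rw [sub_sub_cancel] at this
  rw [← this]
  refine setLIntegral_congr_fun measurableSet_Ioo fun s hs => ?_
  rw [epow_mul_epow (sub_pos.2 hs.2)]
  congr 1
  ring

/-- The bound of `∫_0^u (u-s)^{κ-α-1} ds` on `[0,T]`. -/
def holderBound (α T κ : ℝ) : ℝ≥0∞ := ENNReal.ofReal (κ - α)⁻¹ * epow T (κ - α)

lemma holderBound_ne_top (α T κ : ℝ) : holderBound α T κ ≠ ∞ := by
  unfold holderBound; finiteness [epow_ne_top T (κ - α)]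

lemma setLIntegral_epow_holder_le {T u κ α : ℝ} (hu : u ∈ Icc 0 T) (hκ : α < κ) :
    ∫⁻ s in Ioo 0 u, epow (u - s) κ * epow (u - s) (-(α + 1)) ≤ holderBound α T κ := by
  rw [setLIntegral_epow_holder hu.1 hκ, sub_zero, holderBound]
  gcongr
  exact epow_mono hu.1 hu.2 (by linarith)

lemma wPt_eq {E : Type*} [NormedAddCommGroup E] (α a : ℝ) (f : ℝ → E) (t : ℝ) :
    wPt α a f t = ENNReal.ofReal ‖f t‖ +
      ∫⁻ s in Ioo a t, ENNReal.ofReal ‖f t - f s‖ * epow (t - s) (-(α + 1)) := by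
  rw [wPt]
  congr 1
  exact setLIntegral_congr_fun measurableSet_Ioo fun s hs =>
    ofReal_div_rpow (norm_nonneg _) (sub_pos.2 hs.2) _

/-- A delay moves the base point of the norm from 0 to -r, which is why the a priori bounds on
delayed solutions must include the history interval. -/
lemma wPt_shift {E : Type*} [NormedAddCommGroup E] (α r : ℝ) (z : ℝ → E) (u : ℝ) :
    wPt α 0 (fun s => z (s - r)) u = wPt α (-r) z (u - r) := by
  rw [wPt, wPt]
  congr 1
  have := setLIntegral_Ioo_sub_right
    (fun s => ENNReal.ofReal (‖z (u - r) - z s‖ / (u - r - s) ^ (α + 1))) 0 u r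
  rw [zero_sub] at this
  rw [← this]
  refine lintegral_congr fun s => ?_
  rw [sub_sub_sub_cancel_right]

/-- Lipschitz continuity in space passes the singular integral on to y, and the Hölder modulus in
time is integrable against (u-s)^(-α-1) because β > α. The bound is linear in the norm of y, as the
a priori estimate requires. -/
lemma HypH1.exists_wPt_le {d m : ℕ} {T β δ α : ℝ} (hβ : α < β) (hβ0 : 0 ≤ β)
    {σ : ℝ → EuclideanSpace ℝ (Fin d) → EuclideanSpace ℝ (Fin d × Fin m)}
    (hσ : HypH1 T β δ σ) :
    ∃ K : ℝ≥0∞, K ≠ ∞ ∧ ∀ y : ℝ → EuclideanSpace ℝ (Fin d), ∀ u ∈ Icc 0 T,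
      wPt α 0 (fun s => σ s (y s)) u ≤ K * (1 + wPt α 0 y u) := by
  obtain ⟨M, hM, hlip, htime⟩ := hσ.exists_lipschitz
  set a := ENNReal.ofReal (‖σ 0 0‖ + M * T ^ β) with ha
  set m' := ENNReal.ofReal M with hm'
  have hat : a ≠ ∞ := ENNReal.ofReal_ne_top
  have hmt : m' ≠ ∞ := ENNReal.ofReal_ne_top
  have hbt := holderBound_ne_top α T β
  refine ⟨a + m' * holderBound α T β + m', by finiteness, fun y u hu => ?_⟩
  have hT : (0 : ℝ) ∈ Icc 0 T := ⟨le_rfl, hu.1.trans hu.2⟩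
  have h1 : ENNReal.ofReal ‖σ u (y u)‖ ≤ a + m' * ENNReal.ofReal ‖y u‖ := by
    rw [ha, hm', ← ENNReal.ofReal_mul hM, ← ENNReal.ofReal_add (add_nonneg (norm_nonneg _)
      (mul_nonneg hM (Real.rpow_nonneg hT.2 _))) (mul_nonneg hM (norm_nonneg _))]
    apply ENNReal.ofReal_le_ofReal
    have e : σ u (y u) = σ 0 0 + (σ u 0 - σ 0 0) + (σ u (y u) - σ u 0) := by abel
    have b1 := htime u hu 0 hT 0
    have b2 := hlip u hu (y u) 0
    rw [sub_zero, abs_of_nonneg hu.1] at b1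
    rw [sub_zero] at b2
    have b3 : M * u ^ β ≤ M * T ^ β :=
      mul_le_mul_of_nonneg_left (Real.rpow_le_rpow hu.1 hu.2 hβ0) hM
    calc ‖σ u (y u)‖ ≤ ‖σ 0 0‖ + ‖σ u 0 - σ 0 0‖ + ‖σ u (y u) - σ u 0‖ := by
          conv_lhs => rw [e]
          exact norm_add₃_le
      _ ≤ _ := by linarith
  have h2 : ∫⁻ s in Ioo 0 u, ENNReal.ofReal ‖σ u (y u) - σ s (y s)‖ * epow (u - s) (-(α + 1)) ≤
      m' * holderBound α T β +
        m' * ∫⁻ s in Ioo 0 u, ENNReal.ofReal ‖y u - y s‖ * epow (u - s) (-(α + 1)) := by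
    calc _ ≤ ∫⁻ s in Ioo 0 u, (m' * (epow (u - s) β * epow (u - s) (-(α + 1))) +
          m' * (ENNReal.ofReal ‖y u - y s‖ * epow (u - s) (-(α + 1)))) := by
          refine setLIntegral_mono' measurableSet_Ioo fun s hs => ?_
          have hs' : s ∈ Icc 0 T := ⟨hs.1.le, hs.2.le.trans hu.2⟩
          rw [← mul_assoc, ← mul_assoc, ← add_mul]
          gcongr
          rw [epow, hm', ← ENNReal.ofReal_mul hM, ← ENNReal.ofReal_mul hM,
            ← ENNReal.ofReal_add (mul_nonneg hM (Real.rpow_nonneg (sub_nonneg.2 hs.2.le) _))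
            (mul_nonneg hM (norm_nonneg _))]
          apply ENNReal.ofReal_le_ofReal
          have b1 := htime u hu s hs' (y u)
          have b2 := hlip s hs' (y u) (y s)
          rw [abs_of_pos (sub_pos.2 hs.2)] at b1
          exact (norm_sub_le_norm_sub_add_norm_sub _ (σ s (y u)) _).trans (add_le_add b1 b2)
      _ ≤ _ := by
          rw [lintegral_add_left (by fun_prop), lintegral_const_mul _ (by fun_prop),
            lintegral_const_mul' _ _ hmt]
          gcongr
          exact setLIntegral_epow_holder_le hu hβ
  rw [wPt_eq, wPt_eq]
  set Y := ∫⁻ s in Ioo 0 u, ENNReal.ofReal ‖y u - y s‖ * epow (u - s) (-(α + 1))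
  set H := holderBound α T β
  calc _ ≤ (a + m' * ENNReal.ofReal ‖y u‖) + (m' * H + m' * Y) := add_le_add h1 h2
    _ = (a + m' * H) * 1 + m' * (ENNReal.ofReal ‖y u‖ + Y) := by ring
    _ ≤ (a + m' * H + m') * 1 + (a + m' * H + m') * (ENNReal.ofReal ‖y u‖ + Y) :=
        add_le_add (mul_le_mul_left le_self_add _) (mul_le_mul_left le_add_self _)
    _ = _ := by ring

/-- The second difference can be paired across the delay or across time, giving 2H min(r,
u-s)^(1-α). This is at most 2H r^(1/2-α) (u-s)^(1/2): a positive power of r is gained while the time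
exponent stays above α. -/
lemma norm_delay_sub_le {E : Type*} [NormedAddCommGroup E] {α T r H : ℝ} {z : ℝ → E}
    (hα' : α < 1 / 2) (hr : 0 < r) (hH : 0 ≤ H)
    (hz : ∀ s t, -r ≤ s → s ≤ t → t ≤ T → ‖z t - z s‖ ≤ H * (t - s) ^ (1 - α)) {s u : ℝ}
    (hs : 0 ≤ s) (hsu : s < u) (huT : u ≤ T) :
    ‖(z u - z (u - r)) - (z s - z (s - r))‖ ≤ 2 * H * r ^ (1 / 2 - α) * (u - s) ^ (1 / 2 : ℝ) := by
  have hus : 0 < u - s := sub_pos.2 hsu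
  have split : ∀ {v : ℝ}, 0 < v → v ^ (1 - α) = v ^ (1 / 2 - α) * v ^ (1 / 2 : ℝ) := fun hv => by
    rw [← Real.rpow_add hv]; congr 1; ring
  rcases le_total r (u - s) with h | h
  · have b1 := hz (u - r) u (by linarith) (by linarith) huT
    have b2 := hz (s - r) s (by linarith) (by linarith) (by linarith)
    rw [sub_sub_cancel, split hr] at b1 b2
    have b3 : r ^ (1 / 2 : ℝ) ≤ (u - s) ^ (1 / 2 : ℝ) := Real.rpow_le_rpow hr.le h (by norm_num)
    have b4 : 0 ≤ H * r ^ (1 / 2 - α) := by positivity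
    calc _ ≤ ‖z u - z (u - r)‖ + ‖z s - z (s - r)‖ := norm_sub_le _ _
      _ ≤ 2 * ((H * r ^ (1 / 2 - α)) * r ^ (1 / 2 : ℝ)) := by linarith
      _ ≤ 2 * ((H * r ^ (1 / 2 - α)) * (u - s) ^ (1 / 2 : ℝ)) := by gcongr
      _ = _ := by ring
  · have b1 := hz s u (by linarith) hsu.le huT
    have b2 := hz (s - r) (u - r) (by linarith) (by linarith) (by linarith)
    rw [sub_sub_sub_cancel_right] at b2
    rw [split hus] at b1 b2
    have b3 : (u - s) ^ (1 / 2 - α) ≤ r ^ (1 / 2 - α) := Real.rpow_le_rpow hus.le h (by linarith)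
    calc _ = ‖(z u - z s) - (z (u - r) - z (s - r))‖ := by rw [sub_sub_sub_comm]
      _ ≤ ‖z u - z s‖ + ‖z (u - r) - z (s - r)‖ := norm_sub_le _ _
      _ ≤ 2 * (H * ((u - s) ^ (1 / 2 - α) * (u - s) ^ (1 / 2 : ℝ))) := by linarith
      _ ≤ 2 * (H * (r ^ (1 / 2 - α) * (u - s) ^ (1 / 2 : ℝ))) := by gcongr
      _ = _ := by ring

lemma norm_delay_le {E : Type*} [NormedAddCommGroup E] {α T r r₀ H : ℝ} {z : ℝ → E}
    (hr : 0 < r) (hr₀ : r ≤ r₀) (hH : 0 ≤ H)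
    (hz : ∀ s t, -r ≤ s → s ≤ t → t ≤ T → ‖z t - z s‖ ≤ H * (t - s) ^ (1 - α)) {u : ℝ}
    (hu : u ∈ Icc 0 T) : ‖z u - z (u - r)‖ ≤ H * r₀ ^ (1 / 2 : ℝ) * r ^ (1 / 2 - α) := by
  refine (hz (u - r) u (by linarith [hu.1]) (by linarith) hu.2).trans ?_
  rw [sub_sub_cancel, mul_assoc]
  gcongr
  have e : 1 - α = 1 / 2 + (1 / 2 - α) := by ring
  rw [e, Real.rpow_add hr]
  gcongr

/-- This is where delay and nonlinearity meet. Splitting x(u) - z(u-r) into (x-z)(u) and z(u) -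
z(u-r), the four-point estimate is linear in x-z. The Hölder bounds on x and z turn the δ-Hölder
derivative into (u-s)^((1-α)δ), integrable by the assumption on α. -/
lemma HypH1.exists_wPt_sub_le {d m : ℕ} {T β δ α r₀ N H : ℝ} (hβ : α < β)
    (hδ : 0 < δ) (hδ' : δ ≤ 1) (hα' : α < 1 / 2) (hκ : α < (1 - α) * δ)
    (hN : 0 ≤ N) (hH : 0 ≤ H)
    {σ : ℝ → EuclideanSpace ℝ (Fin d) → EuclideanSpace ℝ (Fin d × Fin m)}
    (hσ : HypH1 T β δ σ) :
    ∃ K : ℝ≥0∞, K ≠ ∞ ∧ ∀ r ∈ Ioc 0 r₀, ∀ x z : ℝ → EuclideanSpace ℝ (Fin d),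
      (∀ u ∈ Icc 0 T, ‖x u‖ ≤ N) → (∀ u ∈ Icc (-r) T, ‖z u‖ ≤ N) →
      (∀ s t, 0 ≤ s → s ≤ t → t ≤ T → ‖x t - x s‖ ≤ H * (t - s) ^ (1 - α)) →
      (∀ s t, -r ≤ s → s ≤ t → t ≤ T → ‖z t - z s‖ ≤ H * (t - s) ^ (1 - α)) →
      ∀ u ∈ Icc 0 T, wPt α 0 (fun s => σ s (x s) - σ s (z (s - r))) u ≤
        K * (wPt α 0 (fun s => x s - z s) u + epow r (1 / 2 - α)) := by
  obtain ⟨-, hd, Mf, hMf, hlip, hder, htime⟩ := hσ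
  set M := Mf 0 with hMdef
  set MN := Mf N
  have hM : 0 ≤ M := (hMf 0 le_rfl).le
  have hMN : 0 ≤ MN := (hMf N hN).le
  set κ := (1 - α) * δ with hκdef
  set m' := ENNReal.ofReal M with hm'
  set H₁ := ENNReal.ofReal (H * r₀ ^ (1 / 2 : ℝ)) with hH₁
  set H₂ := ENNReal.ofReal (2 * H) with hH₂
  set c₁ := ENNReal.ofReal (d * M) with hc₁
  set c₂ := ENNReal.ofReal (d * (MN * (2 * H ^ δ))) with hc₂
  set B := holderBound α T (1 / 2) with hB
  set D := c₁ * holderBound α T β + c₂ * holderBound α T κ with hD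
  have hBt : B ≠ ∞ := holderBound_ne_top _ _ _
  have hDt : D ≠ ∞ := by
    finiteness [holderBound_ne_top α T β, holderBound_ne_top α T κ]
  have hm't : m' ≠ ∞ := ENNReal.ofReal_ne_top
  have hH₁t : H₁ ≠ ∞ := ENNReal.ofReal_ne_top
  have hH₂t : H₂ ≠ ∞ := ENNReal.ofReal_ne_top
  refine ⟨(m' + D) + (m' * H₁ + m' * (H₂ * B) + D * H₁), by finiteness, ?_⟩
  intro r hr x z hxN hzN hx hz u hu
  have hr0 : 0 < r := hr.1
  have hr₀0 : 0 ≤ r₀ := hr.1.le.trans hr.2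
  set ε := epow r (1 / 2 - α) with hε
  set P := ENNReal.ofReal ‖x u - z u‖ + H₁ * ε with hP
  have hPu : ENNReal.ofReal ‖x u - z (u - r)‖ ≤ P := by
    rw [hP, hH₁, hε, epow, ← ENNReal.ofReal_mul (by positivity),
      ← ENNReal.ofReal_add (norm_nonneg _) (by positivity)]
    apply ENNReal.ofReal_le_ofReal
    exact (norm_sub_le_norm_sub_add_norm_sub _ (z u) _).trans
      (add_le_add le_rfl (norm_delay_le hr0 hr.2 hH hz hu))
  have h1 : ENNReal.ofReal ‖σ u (x u) - σ u (z (u - r))‖ ≤ m' * P := by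
    calc _ ≤ ENNReal.ofReal (M * ‖x u - z (u - r)‖) :=
          ENNReal.ofReal_le_ofReal (hlip u hu _ _)
      _ ≤ _ := by rw [ENNReal.ofReal_mul hM]; gcongr
  have h2 : ∀ s ∈ Ioo 0 u, ENNReal.ofReal
      ‖(σ u (x u) - σ u (z (u - r))) - (σ s (x s) - σ s (z (s - r)))‖ ≤
      m' * ENNReal.ofReal ‖(x u - z u) - (x s - z s)‖ + m' * (H₂ * ε * epow (u - s) (1 / 2)) +
        (c₁ * epow (u - s) β + c₂ * epow (u - s) κ) * P := by
    intro s hs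
    have hs' : s ∈ Icc 0 T := ⟨hs.1.le, hs.2.le.trans hu.2⟩
    have hus : 0 < u - s := sub_pos.2 hs.2
    have hur : u - r ∈ Icc (-r) T := ⟨by linarith [hu.1], by linarith [hu.2]⟩
    have hsr : s - r ∈ Icc (-r) T := ⟨by linarith [hs'.1], by linarith [hs'.2]⟩
    -- The four points are x(u), x(s), z(u-r), z(s-r): increments in time feed the Hölder
    -- derivative, while the factor ‖x(u) - z(u-r)‖ carries the smallness.
    have key := norm_four_point_le (β := β) hδ hδ' hM hMN hd hlip
      (fun t ht => hder N hN t ht) htime hu hs' (hxN u hu) (hxN s hs') (hzN _ hur) (hzN _ hsr)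
    have hpow : (H * (u - s) ^ (1 - α)) ^ δ = H ^ δ * (u - s) ^ κ := by
      rw [Real.mul_rpow hH (by positivity), ← Real.rpow_mul hus.le]
    have k1 : ‖x u - x s‖ ^ δ ≤ H ^ δ * (u - s) ^ κ := by
      rw [← hpow]; exact Real.rpow_le_rpow (norm_nonneg _) (hx s u hs.1.le hs.2.le hu.2) hδ.le
    have k2 : ‖z (u - r) - z (s - r)‖ ^ δ ≤ H ^ δ * (u - s) ^ κ := by
      rw [← hpow]
      refine Real.rpow_le_rpow (norm_nonneg _) ?_ hδ.le
      have := hz (s - r) (u - r) hsr.1 (by linarith) hur.2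
      rwa [sub_sub_sub_cancel_right] at this
    have k3 : ‖(x u - z (u - r)) - (x s - z (s - r))‖ ≤ ‖(x u - z u) - (x s - z s)‖ +
        2 * H * r ^ (1 / 2 - α) * (u - s) ^ (1 / 2 : ℝ) := by
      have e : (x u - z (u - r)) - (x s - z (s - r)) = ((x u - z u) - (x s - z s)) +
          ((z u - z (u - r)) - (z s - z (s - r))) := by abel
      rw [e]
      exact (norm_add_le _ _).trans
        (add_le_add le_rfl (norm_delay_sub_le hα' hr0 hH hz hs.1.le hs.2 hu.2))
    rw [abs_of_pos hus] at key
    calc _ ≤ ENNReal.ofReal (M * ‖(x u - z u) - (x s - z s)‖ +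
          M * (2 * H * r ^ (1 / 2 - α) * (u - s) ^ (1 / 2 : ℝ)) +
          (d * M * (u - s) ^ β + d * (MN * (2 * H ^ δ)) * (u - s) ^ κ) * ‖x u - z (u - r)‖) := by
          apply ENNReal.ofReal_le_ofReal
          refine key.trans (add_le_add ?_ (mul_le_mul_of_nonneg_right ?_ (norm_nonneg _)))
          · rw [← mul_add]; exact mul_le_mul_of_nonneg_left k3 hM
          · calc _ ≤ d * (M * (u - s) ^ β + MN * (H ^ δ * (u - s) ^ κ + H ^ δ * (u - s) ^ κ)) := by
                  gcongr
              _ = _ := by ring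
      _ = m' * ENNReal.ofReal ‖(x u - z u) - (x s - z s)‖ +
          m' * (H₂ * ε * epow (u - s) (1 / 2)) +
          (c₁ * epow (u - s) β + c₂ * epow (u - s) κ) * ENNReal.ofReal ‖x u - z (u - r)‖ := by
          rw [ENNReal.ofReal_add (by positivity) (by positivity),
            ENNReal.ofReal_add (by positivity) (by positivity), ENNReal.ofReal_mul hM,
            ENNReal.ofReal_mul hM, ENNReal.ofReal_mul (q := ‖x u - z (u - r)‖) (by positivity),
            ENNReal.ofReal_mul (q := (u - s) ^ (1 / 2 : ℝ)) (by positivity),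
            ENNReal.ofReal_mul (p := 2 * H) (by positivity),
            ENNReal.ofReal_add (by positivity) (by positivity),
            ENNReal.ofReal_mul (p := d * M) (by positivity),
            ENNReal.ofReal_mul (p := d * (MN * (2 * H ^ δ))) (by positivity)]
          rfl
      _ ≤ _ := by gcongr
  rw [wPt_eq, wPt_eq]
  set Y := ∫⁻ s in Ioo 0 u, ENNReal.ofReal ‖(x u - z u) - (x s - z s)‖ * epow (u - s) (-(α + 1))
    with hY
  have h3 : ∫⁻ s in Ioo 0 u, ENNReal.ofReal
      ‖(σ u (x u) - σ u (z (u - r))) - (σ s (x s) - σ s (z (s - r)))‖ * epow (u - s) (-(α + 1)) ≤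
      m' * Y + (m' * (H₂ * ε) * B + D * P) := by
    calc _ ≤ ∫⁻ s in Ioo 0 u,
          (m' * (ENNReal.ofReal ‖(x u - z u) - (x s - z s)‖ * epow (u - s) (-(α + 1))) +
          (m' * (H₂ * ε) * (epow (u - s) (1 / 2) * epow (u - s) (-(α + 1))) +
          (c₁ * (epow (u - s) β * epow (u - s) (-(α + 1))) +
            c₂ * (epow (u - s) κ * epow (u - s) (-(α + 1)))) * P)) := by
          refine setLIntegral_mono' measurableSet_Ioo fun s hs => ?_
          refine (mul_le_mul_left (h2 s hs) _).trans (le_of_eq ?_)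
          ring
      _ ≤ _ := by
          rw [lintegral_add_right _ (by fun_prop), lintegral_const_mul' _ _ hm't,
            lintegral_add_left (by fun_prop), lintegral_const_mul _ (by fun_prop),
            lintegral_mul_const _ (by fun_prop), lintegral_add_left (by fun_prop),
            lintegral_const_mul _ (by fun_prop), lintegral_const_mul _ (by fun_prop)]
          gcongr
          · exact setLIntegral_epow_holder_le hu (by linarith)
          · rw [hD]
            gcongr
            · exact setLIntegral_epow_holder_le hu hβ
            · exact setLIntegral_epow_holder_le hu hκ
  refine (add_le_add h1 h3).trans ?_
  have hP' : m' * P + (m' * Y + (m' * (H₂ * ε) * B + D * P)) =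
      (m' + D) * ENNReal.ofReal ‖x u - z u‖ + m' * Y +
        (m' * H₁ + m' * (H₂ * B) + D * H₁) * ε := by
    rw [hP]; ring
  rw [hP', mul_add, mul_add]
  refine add_le_add (add_le_add ?_ ?_) ?_
  · exact mul_le_mul_left le_self_add _
  · exact mul_le_mul_left (le_self_add.trans le_self_add) _
  · exact mul_le_mul_left le_add_self _

/-! ### Increment bounds for solutions. -/

lemma IncrementBound.of_le {E : Type*} [NormedAddCommGroup E] {α T : ℝ} {c C K : ℝ≥0∞}
    {Ψ Ψ' : ℝ → ℝ≥0∞} {h : ℝ → E} (hh : IncrementBound α T c C Ψ h) (hK : K ≠ ∞)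
    (hΨ : ∀ u ∈ Icc 0 T, Ψ u ≤ K * Ψ' u) : IncrementBound α T c (C * K) Ψ' h := by
  intro s t hs hst ht
  refine (hh s t hs hst ht).trans ?_
  have h1 : ∫⁻ u in Ioo s t, epow u (-α) * Ψ u ≤ K * ∫⁻ u in Ioo s t, epow u (-α) * Ψ' u := by
    rw [← lintegral_const_mul' _ _ hK]
    refine setLIntegral_mono' measurableSet_Ioo fun u hu => ?_
    calc _ ≤ epow u (-α) * (K * Ψ' u) := by
          gcongr
          exact hΨ u ⟨hs.trans hu.1.le, hu.2.le.trans ht⟩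
      _ = _ := by ring
  have h2 : ∫⁻ u in Ioo 0 s, epow (s - u) (-(1 - α)) * epow u (-α) * Ψ u ≤
      K * ∫⁻ u in Ioo 0 s, epow (s - u) (-(1 - α)) * epow u (-α) * Ψ' u := by
    rw [← lintegral_const_mul' _ _ hK]
    refine setLIntegral_mono' measurableSet_Ioo fun u hu => ?_
    calc _ ≤ epow (s - u) (-(1 - α)) * epow u (-α) * (K * Ψ' u) := by
          gcongr
          exact hΨ u ⟨hu.1.le, hu.2.le.trans (hst.le.trans ht)⟩
      _ = _ := by ring
  set I₁ := ∫⁻ u in Ioo s t, epow u (-α) * Ψ' u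
  set I₂ := ∫⁻ u in Ioo 0 s, epow (s - u) (-(1 - α)) * epow u (-α) * Ψ' u
  calc _ ≤ c * epow (t - s) (1 - α) + C * (K * I₁ + epow (t - s) (1 - α) * (K * I₂)) := by
        gcongr
    _ = _ := by ring

/-- Adding an absolutely continuous part to a function with controlled increments. -/
lemma IncrementBound.add_integral {E : Type*} [NormedAddCommGroup E] [NormedSpace ℝ E]
    {α T : ℝ} (hα : 0 < α) {c C l : ℝ≥0∞} {F B q : ℝ → ℝ≥0∞} {V D h : ℝ → E} {h₀ : E}
    (hV : IncrementBound α T 0 C F V) (hl : l ≠ ∞)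
    (hD : IntervalIntegrable D volume 0 T)
    (hDle : ∀ u ∈ Icc 0 T, ENNReal.ofReal ‖D u‖ ≤ q u + l * B u)
    (hq : AEMeasurable q (volume.restrict (Icc 0 T)))
    (hqc : ∀ s t, 0 ≤ s → s < t → t ≤ T → ∫⁻ u in Ioo s t, q u ≤ c * epow (t - s) (1 - α))
    (heq : ∀ t ∈ Icc 0 T, h t = h₀ + (∫ u in (0 : ℝ)..t, D u) + V t) :
    IncrementBound α T c (C + l * epow T α) (fun u => F u + B u) h := by
  intro s t hs hst ht
  have hT : 0 ≤ T := hs.trans (hst.le.trans ht)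
  have sub : ∀ {a b}, 0 ≤ a → a ≤ b → b ≤ T → IntervalIntegrable D volume a b := fun ha hab hb =>
    hD.mono_set (by rw [uIcc_of_le hab, uIcc_of_le hT]; exact Icc_subset_Icc ha hb)
  have e : h t - h s = (∫ u in s..t, D u) + (V t - V s) := by
    rw [heq t ⟨hs.trans hst.le, ht⟩, heq s ⟨hs, hst.le.trans ht⟩,
      ← intervalIntegral.integral_interval_sub_left (sub le_rfl (hs.trans hst.le) ht)
      (sub le_rfl hs (hst.le.trans ht))]
    abel
  set e₁ := epow (t - s) (1 - α)
  set I₁ := ∫⁻ u in Ioo s t, epow u (-α) * (F u + B u) with hI₁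
  set I₂ := ∫⁻ u in Ioo 0 s, epow (s - u) (-(1 - α)) * epow u (-α) * (F u + B u) with hI₂
  have b1 : ENNReal.ofReal ‖∫ u in s..t, D u‖ ≤ c * e₁ + l * (epow T α * I₁) := by
    have hsub : Ioo s t ⊆ Icc 0 T := fun u hu => ⟨hs.trans hu.1.le, hu.2.le.trans ht⟩
    refine (ofReal_norm_intervalIntegral_le hst.le _).trans ?_
    calc _ ≤ ∫⁻ u in Ioo s t, (q u + l * B u) :=
          setLIntegral_mono' measurableSet_Ioo fun u hu => hDle u (hsub hu)
      _ = (∫⁻ u in Ioo s t, q u) + l * ∫⁻ u in Ioo s t, B u := by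
          rw [lintegral_add_left' (hq.mono_measure (Measure.restrict_mono hsub le_rfl)),
            lintegral_const_mul' _ _ hl]
      _ ≤ _ := by
          gcongr
          · exact hqc s t hs hst ht
          · rw [hI₁, ← lintegral_const_mul' _ _ (epow_ne_top _ _)]
            refine setLIntegral_mono' measurableSet_Ioo fun u hu => ?_
            have hu0 : 0 < u := hs.trans_lt hu.1
            -- The drift has no singular weight; multiplying by u^α u^(-α) and bounding u^α by T^α
            -- puts it in the form of the Stieltjes term.
            calc B u = (epow u α * epow u (-α)) * B u := by rw [epow_mul_neg hu0, one_mul]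
              _ ≤ (epow T α * epow u (-α)) * (F u + B u) := by
                gcongr
                · exact epow_mono hu0.le (hu.2.le.trans ht) hα.le
                · exact le_add_self
              _ = _ := by ring
  have b2 : ENNReal.ofReal ‖V t - V s‖ ≤ C * (I₁ + e₁ * I₂) := by
    refine (hV s t hs hst ht).trans ?_
    rw [zero_mul, zero_add]
    rw [hI₁, hI₂]
    gcongr with u u <;> exact le_self_add
  rw [e]
  calc _ ≤ ENNReal.ofReal ‖∫ u in s..t, D u‖ + ENNReal.ofReal ‖V t - V s‖ := by
        rw [← ENNReal.ofReal_add (norm_nonneg _) (norm_nonneg _)]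
        exact ENNReal.ofReal_le_ofReal (norm_add_le _ _)
    _ ≤ c * e₁ + l * (epow T α * I₁) + C * (I₁ + e₁ * I₂) := add_le_add b1 b2
    _ ≤ c * e₁ + l * (epow T α * (I₁ + e₁ * I₂)) + C * (I₁ + e₁ * I₂) := by
        gcongr
        exact le_self_add
    _ = _ := by ring

/-- Hölder's inequality: the exponent 1/α is the one whose conjugate gives the power 1-α of the
interval length, matching the regularity of the Stieltjes integral. -/
lemma lintegral_enorm_le_epow {α T : ℝ} (hα : 0 < α) (hα' : α < 1) {f : ℝ → ℝ}
    (hf : MemLp f (ENNReal.ofReal (1 / α)) (volume.restrict (Icc 0 T))) {s t : ℝ} (hs : 0 ≤ s)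
    (hst : s < t) (ht : t ≤ T) :
    ∫⁻ u in Ioo s t, ‖f u‖ₑ ≤
      eLpNorm f (ENNReal.ofReal (1 / α)) (volume.restrict (Icc 0 T)) * epow (t - s) (1 - α) := by
  have hsub : Ioo s t ⊆ Icc 0 T := fun u hu => ⟨hs.trans hu.1.le, hu.2.le.trans ht⟩
  have hμ : volume.restrict (Ioo s t) ≤ volume.restrict (Icc 0 T) :=
    Measure.restrict_mono hsub le_rfl
  have hp : (1 : ℝ≥0∞) ≤ ENNReal.ofReal (1 / α) :=
    ENNReal.one_le_ofReal.2 (by rw [le_div_iff₀ hα]; linarith)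
  have h := eLpNorm_le_eLpNorm_mul_rpow_measure_univ hp (hf.1.mono_measure hμ)
  rw [eLpNorm_one_eq_lintegral_enorm] at h
  refine h.trans ?_
  gcongr ?_ * ?_
  · exact eLpNorm_mono_measure _ hμ
  · rw [Measure.restrict_apply_univ, Real.volume_Ioo, ENNReal.toReal_one,
      ENNReal.toReal_ofReal (by positivity), one_div_one_div, div_one,
      ENNReal.ofReal_rpow_of_pos (sub_pos.2 hst)]
    rfl

lemma HypH2'.intervalIntegrable {d : ℕ} {T α : ℝ} (hT : 0 ≤ T) (hα : 0 < α) (hα' : α < 1)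
    {b : ℝ → EuclideanSpace ℝ (Fin d) → EuclideanSpace ℝ (Fin d)} (hb : HypH2' T (1 / α) b)
    {z : ℝ → EuclideanSpace ℝ (Fin d)} (hz : MeasOn 0 T z) {N : ℝ}
    (hN : ∀ u ∈ Icc 0 T, ‖z u‖ ≤ N) :
    IntervalIntegrable (fun s => b s (z s)) volume 0 T := by
  obtain ⟨hm, b₀, L, hb₀, hL, -, hgr⟩ := hb
  have hL0 : 0 ≤ L 0 := (hL 0 le_rfl).le
  have hp : (1 : ℝ≥0∞) ≤ ENNReal.ofReal (1 / α) :=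
    ENNReal.one_le_ofReal.2 (by rw [le_div_iff₀ hα]; linarith)
  have hbz : MeasOn 0 T (fun s => b s (z s)) := hm.comp (measurable_id.prodMk hz)
  have haem : AEStronglyMeasurable (fun s => b s (z s)) (volume.restrict (Icc 0 T)) := by
    refine hbz.indicator.aestronglyMeasurable.congr ?_
    exact (ae_restrict_iff' measurableSet_Icc).2
      (ae_of_all _ fun u hu => indicator_of_mem hu _)
  rw [intervalIntegrable_iff_integrableOn_Icc_of_le hT]
  refine Integrable.mono' ((integrable_const (L 0 * N)).add (hb₀.integrable hp)) haem ?_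
  refine (ae_restrict_iff' measurableSet_Icc).2 (ae_of_all _ fun u hu => ?_)
  exact (hgr u hu (z u)).trans
    (add_le_add (mul_le_mul_of_nonneg_left (hN u hu) hL0) le_rfl)

/-- Solutions have controlled increments, with constants that do not depend on the solution. -/
lemma exists_incrementBound {d m : ℕ} {T α β δ Λ : ℝ} (hT : 0 ≤ T) (hα : 0 < α) (hα' : α < 1)
    (hβ : α < β)
    {b : ℝ → EuclideanSpace ℝ (Fin d) → EuclideanSpace ℝ (Fin d)}
    {σ : ℝ → EuclideanSpace ℝ (Fin d) → EuclideanSpace ℝ (Fin d × Fin m)}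
    {g : ℝ → EuclideanSpace ℝ (Fin m)} (hσ : HypH1 T β δ σ) (hb : HypH2' T (1 / α) b)
    (hg : ∀ j, IsIntegrator α T Λ (fun s => g s j)) :
    ∃ c C : ℝ≥0∞, c ≠ ∞ ∧ C ≠ ∞ ∧ ∀ (y z : ℝ → EuclideanSpace ℝ (Fin d))
      (x₀ : EuclideanSpace ℝ (Fin d)) (S : ℝ≥0∞), S ≠ ∞ → MeasOn 0 T y → MeasOn 0 T z →
      (∀ u ∈ Icc 0 T, wPt α 0 y u ≤ S) → (∀ u ∈ Icc 0 T, ENNReal.ofReal ‖z u‖ ≤ S) →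
      (∀ t ∈ Icc 0 T, z t = x₀ + (∫ s in (0 : ℝ)..t, b s (z s)) +
        vecStieltjes α t (fun s => σ s (y s)) g) →
      IncrementBound α T c C (fun u => 1 + wPt α 0 y u + ENNReal.ofReal ‖z u‖) z := by
  obtain ⟨K, hK, hKle⟩ := hσ.exists_wPt_le (α := α) hβ (hα.trans hβ).le
  have hb' := hb
  obtain ⟨-, b₀, L, hb₀, hL, -, hgr⟩ := hb'
  have hL0 : 0 ≤ L 0 := (hL 0 le_rfl).le
  set C₀ : ℝ≥0∞ := d * (m * (leftBound α T * IsIntegrator.weylBound α Λ)) with hC₀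
  have hC₀t : C₀ ≠ ∞ := by
    finiteness [leftBound_ne_top α T, IsIntegrator.weylBound_ne_top α Λ]
  refine ⟨eLpNorm b₀ (ENNReal.ofReal (1 / α)) (volume.restrict (Icc 0 T)),
    C₀ * K + ENNReal.ofReal (L 0) * epow T α, hb₀.2.ne, by finiteness [epow_ne_top T α], ?_⟩
  intro y z x₀ S hS hy hz hyS hzS heq
  -- The bound S depends on the solution but only certifies integrability, so the constants c and C
  -- stay independent of it. Keeping y separate from z covers both equations: y is the shifted
  -- solution or the solution itself.
  have hV := (incrementBound_vecStieltjes hα hα' hg (hσ.measOn_comp hy)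
    (S := K * (1 + S)) (by finiteness)
    (fun u hu => (hKle y u hu).trans (by gcongr; exact hyS u hu))).of_le hK (hKle y)
  refine hV.add_integral hα ENNReal.ofReal_ne_top (hb.intervalIntegrable hT hα hα' hz
    (N := S.toReal) fun u hu => (ENNReal.ofReal_le_iff_le_toReal hS).1 (hzS u hu))
    (q := fun u => ‖b₀ u‖ₑ) ?_ hb₀.1.enorm
    (fun s t hs hst ht => lintegral_enorm_le_epow hα hα' hb₀ hs hst ht) heq
  intro u hu
  rw [← ENNReal.ofReal_mul hL0, ← ofReal_norm, ← ENNReal.ofReal_add (norm_nonneg _)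
    (mul_nonneg hL0 (norm_nonneg _))]
  apply ENNReal.ofReal_le_ofReal
  have := hgr u hu (z u)
  have h2 : b₀ u ≤ ‖b₀ u‖ := Real.le_norm_self _
  linarith

lemma MeasOn.mono {E : Type*} [MeasurableSpace E] {a b a' b' : ℝ} {f : ℝ → E} (hf : MeasOn a b f)
    (ha : a ≤ a') (hb : b' ≤ b) : MeasOn a' b' f :=
  hf.comp (measurable_subtype_coe.subtype_mk
    (h := fun t : Icc a' b' => (⟨ha.trans t.2.1, t.2.2.trans hb⟩ : (t : ℝ) ∈ Icc a b)))

lemma MeasOn.shift {E : Type*} [MeasurableSpace E] {T r : ℝ} (hr : 0 ≤ r) {f : ℝ → E}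
    (hf : MeasOn (-r) T f) : MeasOn 0 T (fun s => f (s - r)) :=
  hf.comp ((measurable_subtype_coe.sub_const r).subtype_mk
    (h := fun t : Icc (0 : ℝ) T => (⟨by linarith [t.2.1], by linarith [t.2.2]⟩ :
      (t : ℝ) - r ∈ Icc (-r) T)))

lemma vecStieltjes_zero {d m : ℕ} (α : ℝ) (A : ℝ → EuclideanSpace ℝ (Fin d × Fin m))
    (g : ℝ → EuclideanSpace ℝ (Fin m)) : vecStieltjes α 0 A g = 0 := by
  ext i
  simp [vecStieltjes, stieltjes]

/-! ### A priori bounds uniform in the delay. -/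

/-- Splitting the history part from `wPt`. -/
lemma wPt_le_add {E : Type*} [NormedAddCommGroup E] {α r v : ℝ} (hα : 0 < α) (hr : 0 ≤ r)
    (hv : 0 < v) (z : ℝ → E) :
    wPt α (-r) z v ≤ ENNReal.ofReal ‖z 0‖ + wPt α (-r) z 0 +
      (1 + ENNReal.ofReal α⁻¹) * (ENNReal.ofReal ‖z v - z 0‖ +
        epow v (-α) * ENNReal.ofReal ‖z v - z 0‖ +
        ∫⁻ s in Ioo 0 v, ENNReal.ofReal (‖z v - z s‖ / (v - s) ^ (α + 1))) := by
  set n := ENNReal.ofReal ‖z v - z 0‖ with hn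
  set J := ∫⁻ s in Ioo 0 v, ENNReal.ofReal (‖z v - z s‖ / (v - s) ^ (α + 1)) with hJ
  set J₀ := ∫⁻ s in Ioo (-r) 0, ENNReal.ofReal (‖z 0 - z s‖ / (0 - s) ^ (α + 1)) with hJ₀
  have h1 : ENNReal.ofReal ‖z v‖ ≤ ENNReal.ofReal ‖z 0‖ + n := by
    rw [hn, ← ENNReal.ofReal_add (norm_nonneg _) (norm_nonneg _)]
    apply ENNReal.ofReal_le_ofReal
    have := norm_add_le (z 0) (z v - z 0)
    rwa [add_sub_cancel] at this
  -- For s < 0 the increment passes through z(0): the part z(v) - z(0) meets a tail integral of size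
  -- v^(-α)/α, and in the part z(0) - z(s) the weight may be replaced by the larger one at time 0.
  have h2 : ∫⁻ s in Ioo (-r) 0, ENNReal.ofReal (‖z v - z s‖ / (v - s) ^ (α + 1)) ≤
      n * (ENNReal.ofReal α⁻¹ * epow v (-α)) + J₀ := by
    calc _ ≤ ∫⁻ s in Ioo (-r) 0, (n * epow (v - s) (-(1 + α)) +
          ENNReal.ofReal (‖z 0 - z s‖ / (0 - s) ^ (α + 1))) := by
          refine setLIntegral_mono' measurableSet_Ioo fun s hs => ?_
          have hvs : 0 < v - s := by linarith [hs.2]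
          have h0s : 0 < 0 - s := by linarith [hs.2]
          rw [ofReal_div_rpow (norm_nonneg _) hvs, ofReal_div_rpow (norm_nonneg _) h0s,
            add_comm 1 α]
          calc _ ≤ (n + ENNReal.ofReal ‖z 0 - z s‖) * epow (v - s) (-(α + 1)) := by
                gcongr
                rw [hn, ← ENNReal.ofReal_add (norm_nonneg _) (norm_nonneg _)]
                exact ENNReal.ofReal_le_ofReal (norm_sub_le_norm_sub_add_norm_sub _ _ _)
            _ ≤ _ := by
                rw [add_mul]
                gcongr
                exact epow_anti h0s (by linarith) (by linarith)
      _ = n * (∫⁻ s in Ioo (-r) 0, epow (v - s) (-(1 + α))) + J₀ := by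
          rw [lintegral_add_left (by fun_prop), lintegral_const_mul _ (by fun_prop)]
      _ ≤ _ := by
          gcongr
          have := setLIntegral_epow_tail_left (a := -r) hv hα
          rwa [sub_zero] at this
  have h3 : ∫⁻ s in Ioo (-r) v, ENNReal.ofReal (‖z v - z s‖ / (v - s) ^ (α + 1)) ≤
      (n * (ENNReal.ofReal α⁻¹ * epow v (-α)) + J₀) + J := by
    have hU : Ioc (-r) v = Ioc (-r) 0 ∪ Ioc 0 v := (Ioc_union_Ioc_eq_Ioc (by linarith) hv.le).symm
    rw [restrict_Ioo_eq_restrict_Ioc, hU]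
    refine (lintegral_union_le _ _ _).trans ?_
    rw [← restrict_Ioo_eq_restrict_Ioc, ← restrict_Ioo_eq_restrict_Ioc]
    exact add_le_add h2 le_rfl
  calc wPt α (-r) z v ≤ (ENNReal.ofReal ‖z 0‖ + n) +
        ((n * (ENNReal.ofReal α⁻¹ * epow v (-α)) + J₀) + J) := add_le_add h1 h3
    _ = ENNReal.ofReal ‖z 0‖ + J₀ + (n + ENNReal.ofReal α⁻¹ * (epow v (-α) * n) + J) := by ring
    _ ≤ ENNReal.ofReal ‖z 0‖ + wPt α (-r) z 0 +
        ((1 + ENNReal.ofReal α⁻¹) * n + (1 + ENNReal.ofReal α⁻¹) * (epow v (-α) * n) +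
          (1 + ENNReal.ofReal α⁻¹) * J) := by
        have one_le : 1 ≤ 1 + ENNReal.ofReal α⁻¹ := le_self_add
        gcongr
        · exact le_add_self
        · exact le_mul_of_one_le_left zero_le one_le
        · exact le_add_self
        · exact le_mul_of_one_le_left zero_le one_le
    _ = _ := by ring

section solutions

variable {d m : ℕ} {T α β δ r₀ : ℝ}
  {b : ℝ → EuclideanSpace ℝ (Fin d) → EuclideanSpace ℝ (Fin d)}
  {σ : ℝ → EuclideanSpace ℝ (Fin d) → EuclideanSpace ℝ (Fin d × Fin m)}
  {g : ℝ → EuclideanSpace ℝ (Fin m)} {η : ℝ → EuclideanSpace ℝ (Fin d)}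

lemma IsDelaySolution.eq_on {r : ℝ} {z : ℝ → EuclideanSpace ℝ (Fin d)} (hr : 0 ≤ r)
    (hz : IsDelaySolution α T r b σ g η z) {t : ℝ} (ht : t ∈ Icc 0 T) :
    z t = η 0 + (∫ s in (0 : ℝ)..t, b s (z s)) +
      vecStieltjes α t (fun s => σ s (z (s - r))) g := by
  rcases ht.1.eq_or_lt with h | h
  · rw [← h, intervalIntegral.integral_same, vecStieltjes_zero, add_zero, add_zero]
    exact hz.2.2 0 ⟨by linarith, le_rfl⟩
  · exact hz.2.1 t ⟨h, ht.2⟩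

/-- On the history interval, `wPt` of a solution is controlled by the initial datum. -/
lemma IsDelaySolution.wPt_history_le {r : ℝ} {z : ℝ → EuclideanSpace ℝ (Fin d)} (hr : r ≤ r₀)
    (hz : IsDelaySolution α T r b σ g η z) {v : ℝ} (hv : v ∈ Icc (-r) 0) :
    wPt α (-r) z v ≤ wNorm α (-r₀) 0 η := by
  rw [wPt_congr hv.1 fun s hs => hz.2.2 s ⟨hs.1, hs.2.trans hv.2⟩]
  refine le_trans ?_ (wPt_le_wNorm η ⟨by linarith [hv.1], hv.2⟩)
  exact add_le_add le_rfl (lintegral_mono_set (Ioo_subset_Ioo_left (by linarith)))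

variable (hT : 0 ≤ T) (hα : 0 < α) (hα' : α < 1 / 2) (hβ : α < β) (hσ : HypH1 T β δ σ)
  (hb : HypH2' T (1 / α) b) (hg : MemWT α T g) (hη : MemW α (-r₀) 0 η)
include hT hα hα' hβ hσ hb hg hη

/-- The norms of the delayed solutions are bounded uniformly in the delay. -/
lemma exists_wPt_delay_le :
    ∃ K : ℝ≥0∞, K ≠ ∞ ∧ ∀ r ∈ Ioc 0 r₀, ∀ z, IsDelaySolution α T r b σ g η z →
      ∀ v ∈ Icc (-r) T, wPt α (-r) z v ≤ K := by
  obtain ⟨Λ, hΛ⟩ := hg.exists_isIntegrator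
  obtain ⟨c, C, hc, hC, hinc⟩ := exists_incrementBound hT hα (by linarith) hβ hσ hb hΛ
  obtain ⟨K₁, hK₁, hle⟩ :=
    IncrementBound.exists_le (E := EuclideanSpace ℝ (Fin d)) (T := T) hα hα'
  set A := 1 + ENNReal.ofReal α⁻¹ with hA
  have hAt : A ≠ ∞ := by finiteness
  set W := wNorm α (-r₀) 0 η with hW
  have hWt : W ≠ ∞ := hη.2.ne
  obtain ⟨G, hG, hgron⟩ := gronwall_kernel (T := T) hα hα'
    (C := A * (K₁ * (C * 2))) (by finiteness)
  refine ⟨G * (1 + W + (W + W) + A * (K₁ * c)) + W, by finiteness, ?_⟩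
  intro r hr z hz v hv
  rcases le_total v 0 with hv0 | hv0
  · exact (hz.wPt_history_le hr.2 ⟨hv.1, hv0⟩).trans le_add_self
  have hzt := hz.1.2.ne
  have hm := hz.1.1
  have hW0 : wPt α (-r) z 0 ≤ W := hz.wPt_history_le hr.2 ⟨by linarith [hr.1], le_rfl⟩
  have hz0 : ENNReal.ofReal ‖z 0‖ ≤ W := le_self_add.trans hW0
  have hinc' := hinc (fun s => z (s - r)) z (η 0) (wNorm α (-r) T z) hzt
    (hm.shift hr.1.le) (hm.mono (by linarith [hr.1]) le_rfl)
    (fun u hu => by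
      rw [wPt_shift]
      exact wPt_le_wNorm z ⟨by linarith [hu.1], by linarith [hu.2, hr.1]⟩)
    (fun u hu => le_self_add.trans
      (wPt_le_wNorm (α := α) z ⟨by linarith [hu.1, hr.1], hu.2⟩))
    (fun t ht => hz.eq_on hr.1.le ht)
  -- The added constant 1 + W lets the running supremum of φ over [0,u] dominate also the delayed
  -- times u-r that fall in the history, and the constant term of the growth bound.
  set φ : ℝ → ℝ≥0∞ := fun v => 1 + W + wPt α (-r) z v with hφ
  have hφsup : ⨆ t ∈ Icc 0 T, φ t ≠ ∞ := by
    refine ne_top_of_le_ne_top (b := 1 + W + wNorm α (-r) T z) (by finiteness)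
      (iSup₂_le fun t ht => ?_)
    exact add_le_add le_rfl (wPt_le_wNorm z ⟨by linarith [ht.1, hr.1], ht.2⟩)
  -- The factor 2 counts the delayed diffusion norm and the undelayed drift norm, each below the
  -- running supremum.
  have hΨ : ∀ u, 0 ≤ u → 1 + wPt α 0 (fun s => z (s - r)) u + ENNReal.ofReal ‖z u‖ ≤
      2 * ⨆ v ∈ Icc 0 u, φ v := by
    intro u hu
    have hmem : ∀ v ∈ Icc 0 u, φ v ≤ ⨆ v ∈ Icc 0 u, φ v := fun v hv =>
      le_iSup₂ (f := fun v (_ : v ∈ Icc 0 u) => φ v) v hv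
    rw [two_mul, wPt_shift]
    refine add_le_add ?_ ?_
    · rcases le_total (u - r) 0 with h | h
      · refine le_trans ?_ (hmem 0 ⟨le_rfl, hu⟩)
        exact (add_le_add le_rfl (hz.wPt_history_le hr.2 ⟨by linarith, h⟩)).trans le_self_add
      · refine le_trans ?_ (hmem (u - r) ⟨h, by linarith [hr.1]⟩)
        exact add_le_add le_self_add le_rfl
    · exact (le_self_add.trans le_add_self).trans (hmem u ⟨hu, le_rfl⟩)
  have hmain : ∀ t ∈ Icc 0 T, φ t ≤ (1 + W + (W + W) + A * (K₁ * c)) +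
      (A * (K₁ * (C * 2))) * ∫⁻ u in Ioo 0 t, kernel α t u * ⨆ v ∈ Icc 0 u, φ v := by
    intro t ht
    rcases ht.1.eq_or_lt with h | h
    · rw [← h]
      calc φ 0 ≤ 1 + W + (W + W) := add_le_add le_rfl (hW0.trans le_self_add)
        _ ≤ _ := le_self_add.trans le_self_add
    have h1 := hle c C _ z ?_ hinc' t ⟨h, ht.2⟩
    · have h2 : ∫⁻ u in Ioo 0 t, kernel α t u *
          (1 + wPt α 0 (fun s => z (s - r)) u + ENNReal.ofReal ‖z u‖) ≤
          2 * ∫⁻ u in Ioo 0 t, kernel α t u * ⨆ v ∈ Icc 0 u, φ v := by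
        rw [← lintegral_const_mul' _ _ (by finiteness)]
        refine setLIntegral_mono' measurableSet_Ioo fun u hu => ?_
        calc _ ≤ kernel α t u * (2 * ⨆ v ∈ Icc 0 u, φ v) := by
              gcongr
              exact hΨ u hu.1.le
          _ = _ := by ring
      set I := ∫⁻ u in Ioo 0 t, kernel α t u * ⨆ v ∈ Icc 0 u, φ v
      calc φ t ≤ 1 + W + ((W + W) + A * (K₁ * (c + C * (2 * I)))) := by
            refine add_le_add le_rfl ((wPt_le_add hα hr.1.le h z).trans ?_)
            gcongr
            exact h1.trans (by gcongr)
        _ = _ := by ring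
    · exact ((measurable_const.add ((hm.shift hr.1.le).wPt α)).add
        (hm.mono (by linarith [hr.1]) le_rfl).norm.ennreal_ofReal)
  have := hgron φ _ hφsup hmain v ⟨hv0, hv.2⟩
  exact (le_add_self.trans this).trans le_self_add

/-- The delayed solutions are Hölder continuous, uniformly in the delay. -/
lemma exists_holder_delay (hη' : MemHolder (1 - α) (-r₀) 0 η) :
    ∃ H : ℝ, 0 ≤ H ∧ ∀ r ∈ Ioc 0 r₀, ∀ z, IsDelaySolution α T r b σ g η z →
      ∀ s t, -r ≤ s → s ≤ t → t ≤ T → ‖z t - z s‖ ≤ H * (t - s) ^ (1 - α) := by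
  obtain ⟨Λ, hΛ⟩ := hg.exists_isIntegrator
  obtain ⟨c, C, hc, hC, hinc⟩ := exists_incrementBound hT hα (by linarith) hβ hσ hb hΛ
  obtain ⟨K, hK, hKle⟩ := exists_wPt_delay_le hT hα hα' hβ hσ hb hg hη
  set H₁ := c + C * ((ENNReal.ofReal (1 - α)⁻¹ + betaBound (1 - α) α) * (1 + K + K)) with hH₁
  have hH₁t : H₁ ≠ ∞ := by finiteness [betaBound_ne_top (1 - α) α]
  set H₂ := holderNorm (1 - α) (-r₀) 0 η with hH₂
  have hH₂t : H₂ ≠ ∞ := hη'.ne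
  refine ⟨H₁.toReal + H₂.toReal, by positivity, ?_⟩
  intro r hr z hz
  have hm := hz.1.1
  have pos : ∀ s t, 0 ≤ s → s < t → t ≤ T → ‖z t - z s‖ ≤ H₁.toReal * (t - s) ^ (1 - α) := by
    intro s t hs hst ht
    have hinc' := hinc (fun s => z (s - r)) z (η 0) K hK
      (hm.shift hr.1.le) (hm.mono (by linarith [hr.1]) le_rfl)
      (fun u hu => by
        rw [wPt_shift]
        exact hKle r hr z hz _ ⟨by linarith [hu.1], by linarith [hu.2, hr.1]⟩)
      (fun u hu => le_self_add.trans (hKle r hr z hz _ ⟨by linarith [hu.1, hr.1], hu.2⟩))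
      (fun t ht => hz.eq_on hr.1.le ht)
    have h := hinc'.holder hα hα' (S := 1 + K + K) (fun u hu => by
      refine add_le_add (add_le_add le_rfl ?_)
        (le_self_add.trans (hKle r hr z hz _ ⟨by linarith [hu.1, hr.1], hu.2⟩))
      rw [wPt_shift]
      exact hKle r hr z hz _ ⟨by linarith [hu.1], by linarith [hu.2, hr.1]⟩) hs hst ht
    rw [← hH₁, ← ENNReal.ofReal_toReal hH₁t, epow, ← ENNReal.ofReal_mul (by positivity)] at h
    exact (ENNReal.ofReal_le_ofReal_iff (mul_nonneg (by positivity)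
      (Real.rpow_nonneg (by linarith) _))).1 h
  have neg : ∀ s t, -r ≤ s → s < t → t ≤ 0 → ‖z t - z s‖ ≤ H₂.toReal * (t - s) ^ (1 - α) := by
    intro s t hs hst ht
    rw [hz.2.2 t ⟨by linarith, ht⟩, hz.2.2 s ⟨hs, by linarith⟩,
      ← div_le_iff₀ (Real.rpow_pos_of_pos (sub_pos.2 hst) _)]
    refine (ENNReal.ofReal_le_iff_le_toReal hH₂t).1 (le_trans ?_ le_add_self)
    refine le_trans ?_ (le_iSup₂ (f := fun s (_ : s ∈ Icc (-r₀) 0) => ⨆ t ∈ Ioc s 0,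
      ENNReal.ofReal (‖η t - η s‖ / (t - s) ^ (1 - α))) s ⟨by linarith [hr.2], by linarith⟩)
    exact le_iSup₂ (f := fun t (_ : t ∈ Ioc s 0) =>
      ENNReal.ofReal (‖η t - η s‖ / (t - s) ^ (1 - α))) t ⟨hst, ht⟩
  have n₁ : 0 ≤ H₁.toReal := ENNReal.toReal_nonneg
  have n₂ : 0 ≤ H₂.toReal := ENNReal.toReal_nonneg
  intro s t hs hst ht
  rcases hst.eq_or_lt with rfl | hst
  · rw [sub_self, norm_zero]
    exact mul_nonneg (by positivity) (Real.rpow_nonneg (by linarith) _)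
  have hts : 0 ≤ (t - s) ^ (1 - α) := Real.rpow_nonneg (by linarith) _
  rcases le_or_gt 0 s with h0 | h0
  · exact (pos s t h0 hst ht).trans (mul_le_mul_of_nonneg_right (by linarith) hts)
  rcases le_or_gt t 0 with h1 | h1
  · exact (neg s t hs hst h1).trans (mul_le_mul_of_nonneg_right (by linarith) hts)
  -- An increment crossing time 0 is split there, so the constants of the two sides add up.
  · have b1 := (pos 0 t le_rfl h1 ht).trans (mul_le_mul_of_nonneg_left
      (Real.rpow_le_rpow (by linarith) (by linarith : t - 0 ≤ t - s) (by linarith)) n₁)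
    have b2 := (neg s 0 hs h0 le_rfl).trans (mul_le_mul_of_nonneg_left
      (Real.rpow_le_rpow (by linarith) (by linarith : 0 - s ≤ t - s) (by linarith)) n₂)
    rw [add_mul]
    exact (norm_sub_le_norm_sub_add_norm_sub _ (z 0) _).trans (add_le_add b1 b2)

omit hη in
/-- A solution of the equation without delay is Hölder continuous. -/
lemma IsSolution.exists_holder {x₀ : EuclideanSpace ℝ (Fin d)} {x : ℝ → EuclideanSpace ℝ (Fin d)}
    (hx : IsSolution α T b σ g x₀ x) :
    ∃ H : ℝ, 0 ≤ H ∧ ∀ s t, 0 ≤ s → s ≤ t → t ≤ T → ‖x t - x s‖ ≤ H * (t - s) ^ (1 - α) := by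
  obtain ⟨Λ, hΛ⟩ := hg.exists_isIntegrator
  obtain ⟨c, C, hc, hC, hinc⟩ := exists_incrementBound hT hα (by linarith) hβ hσ hb hΛ
  set K := wNorm α 0 T x with hKdef
  have hK : K ≠ ∞ := hx.1.2.ne
  have hx1 : ∀ u ∈ Icc 0 T, wPt α 0 x u ≤ K := fun u hu => wPt_le_wNorm x hu
  have hx2 : ∀ u ∈ Icc 0 T, ENNReal.ofReal ‖x u‖ ≤ K := fun u hu => le_self_add.trans (hx1 u hu)
  have hinc' := hinc x x x₀ K hK hx.1.1 hx.1.1 hx1 hx2 hx.2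
  set H₁ := c + C * ((ENNReal.ofReal (1 - α)⁻¹ + betaBound (1 - α) α) * (1 + K + K)) with hH₁
  have hH₁t : H₁ ≠ ∞ := by finiteness [betaBound_ne_top (1 - α) α]
  refine ⟨H₁.toReal, by positivity, fun s t hs hst ht => ?_⟩
  rcases hst.eq_or_lt with rfl | hst
  · rw [sub_self, norm_zero]
    exact mul_nonneg (by positivity) (Real.rpow_nonneg (by linarith) _)
  have h := hinc'.holder hα hα' (S := 1 + K + K)
    (fun u hu => add_le_add (add_le_add le_rfl (hx1 u hu)) (hx2 u hu)) hs hst ht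
  rw [← hH₁, ← ENNReal.ofReal_toReal hH₁t, epow, ← ENNReal.ofReal_mul (by positivity)] at h
  exact (ENNReal.ofReal_le_ofReal_iff (mul_nonneg (by positivity)
    (Real.rpow_nonneg (by linarith) _))).1 h

end solutions

/-! ### Comparison of the delayed and undelayed solutions. -/

lemma wPt_sub_le {E : Type*} [NormedAddCommGroup E] [MeasurableSpace E] [BorelSpace E]
    [SecondCountableTopology E] {α a b t : ℝ} {f f' : ℝ → E} (hf : MeasOn a b f)
    (ht : t ∈ Icc a b) :
    wPt α a (fun s => f s - f' s) t ≤ wPt α a f t + wPt α a f' t := by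
  have hm : Measurable ((Icc a b).indicator f) := hf.indicator
  have hae : AEMeasurable (fun s => ENNReal.ofReal ‖f t - f s‖ * epow (t - s) (-(α + 1)))
      (volume.restrict (Ioo a t)) := by
    have h : Measurable fun s => ENNReal.ofReal ‖f t - (Icc a b).indicator f s‖ *
        epow (t - s) (-(α + 1)) := by fun_prop
    refine h.aemeasurable.congr ?_
    refine (ae_restrict_iff' measurableSet_Ioo).2 (ae_of_all _ fun s hs => ?_)
    simp only [indicator_of_mem (show s ∈ Icc a b from ⟨hs.1.le, hs.2.le.trans ht.2⟩)]
  rw [wPt_eq, wPt_eq, wPt_eq]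
  have h1 : ENNReal.ofReal ‖f t - f' t‖ ≤ ENNReal.ofReal ‖f t‖ + ENNReal.ofReal ‖f' t‖ := by
    rw [← ENNReal.ofReal_add (norm_nonneg _) (norm_nonneg _)]
    exact ENNReal.ofReal_le_ofReal (norm_sub_le _ _)
  have h2 : ∫⁻ s in Ioo a t, ENNReal.ofReal ‖(f t - f' t) - (f s - f' s)‖ *
      epow (t - s) (-(α + 1)) ≤
      (∫⁻ s in Ioo a t, ENNReal.ofReal ‖f t - f s‖ * epow (t - s) (-(α + 1))) +
      ∫⁻ s in Ioo a t, ENNReal.ofReal ‖f' t - f' s‖ * epow (t - s) (-(α + 1)) := by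
    rw [← lintegral_add_left' hae]
    refine lintegral_mono fun s => ?_
    rw [← add_mul]
    gcongr
    rw [← ENNReal.ofReal_add (norm_nonneg _) (norm_nonneg _), sub_sub_sub_comm]
    exact ENNReal.ofReal_le_ofReal (norm_sub_le _ _)
  exact (add_le_add h1 h2).trans (le_of_eq (by abel))

lemma lintegral_kernel_le {α T t : ℝ} (hα : 0 < α) (hα' : α < 1 / 2) (ht : t ∈ Ioc 0 T) :
    ∫⁻ u in Ioo 0 t, kernel α t u ≤ betaBound α α * epow T (1 - α - α) := by
  have h := setLIntegral_beta_le ht.1 hα.le (by linarith) hα.le (by linarith : α < 1)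
  simp only [sub_zero] at h
  refine h.trans ?_
  gcongr
  exact epow_mono ht.1.le ht.2 (by linarith)

section solutions

variable {d m : ℕ} {T α β δ r₀ : ℝ}
  {b : ℝ → EuclideanSpace ℝ (Fin d) → EuclideanSpace ℝ (Fin d)}
  {σ : ℝ → EuclideanSpace ℝ (Fin d) → EuclideanSpace ℝ (Fin d × Fin m)}
  {g : ℝ → EuclideanSpace ℝ (Fin m)} {η : ℝ → EuclideanSpace ℝ (Fin d)}

/-- The distance between the delayed and the undelayed solution is of order `r ^ (1/2 - α)`. -/
lemma exists_wNorm_sub_le (hT : 0 ≤ T) (hδ : 0 < δ) (hδ' : δ ≤ 1) (hα : 0 < α) (hα' : α < 1 / 2)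
    (hβ : α < β) (hκ : α < (1 - α) * δ) (hσ : HypH1 T β δ σ)
    (hb : HypH2' T (1 / α) b) (hg : MemWT α T g) (hη : MemW α (-r₀) 0 η)
    (hη' : MemHolder (1 - α) (-r₀) 0 η) {x : ℝ → EuclideanSpace ℝ (Fin d)}
    (hx : IsSolution α T b σ g (η 0) x) :
    ∃ K : ℝ≥0∞, K ≠ ∞ ∧ ∀ r ∈ Ioc 0 r₀, ∀ z, IsDelaySolution α T r b σ g η z →
      wNorm α 0 T (fun t => x t - z t) ≤ K * epow r (1 / 2 - α) := by
  obtain ⟨Λ, hΛ⟩ := hg.exists_isIntegrator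
  obtain ⟨Kz, hKz, hKzle⟩ := exists_wPt_delay_le hT hα hα' hβ hσ hb hg hη
  obtain ⟨Hz, hHz, hzH⟩ := exists_holder_delay hT hα hα' hβ hσ hb hg hη hη'
  obtain ⟨Hx, hHx, hxH⟩ := hx.exists_holder hT hα hα' hβ hσ hb hg
  set Kx := wNorm α 0 T x with hKx
  have hKxt : Kx ≠ ∞ := hx.1.2.ne
  -- One radius contains x and all delayed solutions, so the local constants of b and ∂σ are fixed
  -- before r is chosen.
  set N := Kx.toReal + Kz.toReal with hN
  have hN0 : 0 ≤ N := by positivity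
  have hxN : ∀ u ∈ Icc 0 T, ‖x u‖ ≤ N := fun u hu =>
    ((ENNReal.ofReal_le_iff_le_toReal hKxt).1 (le_self_add.trans
      (wPt_le_wNorm (α := α) x hu))).trans (le_add_of_nonneg_right ENNReal.toReal_nonneg)
  obtain ⟨Kσ, hKσ, hKσle⟩ := hσ.exists_wPt_le (α := α) hβ (hα.trans hβ).le
  obtain ⟨K₂, hK₂, hK₂le⟩ := hσ.exists_wPt_sub_le (r₀ := r₀) hβ hδ hδ' hα' hκ hN0
    (add_nonneg hHx hHz)
  obtain ⟨K₁, hK₁, hle⟩ :=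
    IncrementBound.exists_le (E := EuclideanSpace ℝ (Fin d)) (T := T) hα hα'
  have hb' := hb
  obtain ⟨-, -, L, -, hL, hlip, -⟩ := hb'
  set C₀ : ℝ≥0∞ := d * (m * (leftBound α T * IsIntegrator.weylBound α Λ)) with hC₀
  have hC₀t : C₀ ≠ ∞ := by
    finiteness [leftBound_ne_top α T, IsIntegrator.weylBound_ne_top α Λ]
  -- In the last factor, K₂ comes from the diffusion difference and 1 from the drift difference,
  -- both measured against the norm of h plus ε.
  set C₁ := (C₀ + ENNReal.ofReal (L N) * epow T α) * (K₂ + 1) with hC₁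
  have hC₁t : C₁ ≠ ∞ := by finiteness [epow_ne_top T α]
  obtain ⟨G, hG, hgron⟩ := gronwall_kernel (T := T) hα hα' (C := K₁ * C₁) (by finiteness)
  set B := betaBound α α * epow T (1 - α - α) with hB
  have hBt : B ≠ ∞ := by finiteness [betaBound_ne_top α α, epow_ne_top T (1 - α - α)]
  refine ⟨G * (K₁ * C₁ * B), by finiteness, fun r hr z hz => ?_⟩
  have hzm : MeasOn 0 T z := hz.1.1.mono (by linarith [hr.1]) le_rfl
  have hzK : ∀ u ∈ Icc (-r) T, ENNReal.ofReal ‖z u‖ ≤ Kz := fun u hu =>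
    le_self_add.trans (hKzle r hr z hz u hu)
  have hsub : Icc 0 T ⊆ Icc (-r) T := Icc_subset_Icc_left (by linarith [hr.1])
  have hzN : ∀ u ∈ Icc (-r) T, ‖z u‖ ≤ N := fun u hu =>
    ((ENNReal.ofReal_le_iff_le_toReal hKz).1 (hzK u hu)).trans
      (le_add_of_nonneg_left ENNReal.toReal_nonneg)
  have hz0 : ∀ u ∈ Icc 0 T, wPt α 0 z u ≤ Kz := fun u hu => le_trans
    (add_le_add le_rfl (lintegral_mono_set (Ioo_subset_Ioo_left (by linarith [hr.1]))))
    (hKzle r hr z hz u (hsub hu))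
  set h : ℝ → EuclideanSpace ℝ (Fin d) := fun t => x t - z t with hh
  set ε := epow r (1 / 2 - α) with hε
  have hεt : ε ≠ ∞ := epow_ne_top _ _
  have hhK : ∀ u ∈ Icc 0 T, wPt α 0 h u ≤ Kx + Kz := fun u hu =>
    (wPt_sub_le hx.1.1 hu).trans (add_le_add (wPt_le_wNorm x hu) (hz0 u hu))
  have hfle := hK₂le r hr x z hxN hzN
    (fun s t hs hst ht => (hxH s t hs hst ht).trans (mul_le_mul_of_nonneg_right (by linarith)
      (Real.rpow_nonneg (by linarith) _)))
    (fun s t hs hst ht => (hzH r hr z hz s t hs hst ht).trans (mul_le_mul_of_nonneg_right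
      (by linarith) (Real.rpow_nonneg (by linarith) _)))
  have hσx : MeasOn 0 T (fun s => σ s (x s)) := hσ.measOn_comp hx.1.1
  have hσz : MeasOn 0 T (fun s => σ s (z (s - r))) := hσ.measOn_comp (hz.1.1.shift hr.1.le)
  have hσxz : MeasOn 0 T (fun s => σ s (x s) - σ s (z (s - r))) := Measurable.sub hσx hσz
  have hV := incrementBound_vecStieltjes hα (by linarith) hΛ hσxz
    (S := K₂ * (Kx + Kz + ε)) (by finiteness)
    (fun u hu => (hfle u hu).trans (by gcongr; exact hhK u hu))
  have ix := hb.intervalIntegrable hT hα (by linarith) hx.1.1 hxN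
  have iz := hb.intervalIntegrable hT hα (by linarith) hzm fun u hu => hzN u (hsub hu)
  have heq : ∀ t ∈ Icc 0 T, h t = 0 + (∫ s in (0 : ℝ)..t, (b s (x s) - b s (z s))) +
      vecStieltjes α t (fun s => σ s (x s) - σ s (z (s - r))) g := by
    intro t ht
    have hsub' : uIcc 0 t ⊆ uIcc 0 T := by
      rw [uIcc_of_le ht.1, uIcc_of_le hT]; exact Icc_subset_Icc_right ht.2
    rw [vecStieltjes_sub hα (by linarith) hΛ hσx hσz (S := Kσ * (1 + (Kx + Kz))) (by finiteness)
      (fun u hu => (hKσle x u hu).trans (by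
        gcongr; exact (wPt_le_wNorm x hu).trans le_self_add))
      (fun u hu => (hKσle (fun s => z (s - r)) u hu).trans (by
        gcongr
        rw [wPt_shift]
        exact (hKzle r hr z hz _ ⟨by linarith [hu.1], by linarith [hu.2, hr.1]⟩).trans
          le_add_self)) ht,
      intervalIntegral.integral_sub (ix.mono_set hsub') (iz.mono_set hsub')]
    simp only [hh]
    rw [hx.2 t ht, hz.eq_on hr.1.le ht]
    abel
  -- The drift difference is Lipschitz in h with no inhomogeneous part, so the Hölder term vanishes
  -- and ε is the only source term.
  have hinc : IncrementBound α T 0 C₁ (fun u => wPt α 0 h u + ε) h := by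
    refine IncrementBound.of_le (hV.add_integral hα (c := 0) (q := 0) (l := ENNReal.ofReal (L N))
      (B := fun u => ENNReal.ofReal ‖h u‖) ENNReal.ofReal_ne_top (ix.sub iz) ?_
      aemeasurable_const ?_ heq) (by finiteness) ?_
    · intro u hu
      rw [Pi.zero_apply, zero_add, ← ENNReal.ofReal_mul (hL N hN0).le]
      exact ENNReal.ofReal_le_ofReal (hlip N hN0 u hu _ _ (hxN u hu) (hzN u (hsub hu)))
    · intro s t _ _ _
      simp
    · intro u hu
      rw [add_mul, one_mul]
      exact add_le_add (hfle u hu) (le_self_add.trans le_self_add)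
  have hh0 : h 0 = 0 := by
    have h00 : (0 : ℝ) ∈ Icc 0 T := ⟨le_rfl, hT⟩
    rw [heq 0 h00, intervalIntegral.integral_same, vecStieltjes_zero, add_zero, add_zero]
  have hhm : MeasOn 0 T h := hx.1.1.sub hzm
  -- Since h(0) = 0, there is no initial term; the constant ε is integrated against the kernel,
  -- which costs `B`.
  have hmain : ∀ t ∈ Icc 0 T, wPt α 0 h t ≤ K₁ * C₁ * B * ε +
      K₁ * C₁ * ∫⁻ u in Ioo 0 t, kernel α t u * ⨆ v ∈ Icc 0 u, wPt α 0 h v := by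
    intro t ht
    rcases ht.1.eq_or_lt with h0 | h0
    · rw [← h0, wPt, hh0]
      simp
    have hΨm : MeasOn 0 T (fun u => wPt α 0 h u + ε) := Measurable.add (hhm.wPt α) measurable_const
    have h1 := hle 0 C₁ _ h hΨm hinc t ⟨h0, ht.2⟩
    rw [hh0, sub_zero, zero_add] at h1
    have h2 : ∫⁻ u in Ioo 0 t, kernel α t u * (wPt α 0 h u + ε) ≤
        (∫⁻ u in Ioo 0 t, kernel α t u * ⨆ v ∈ Icc 0 u, wPt α 0 h v) + B * ε := by
      calc _ ≤ ∫⁻ u in Ioo 0 t,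
            ((kernel α t u * ⨆ v ∈ Icc 0 u, wPt α 0 h v) + kernel α t u * ε) := by
            refine setLIntegral_mono' measurableSet_Ioo fun u hu => ?_
            rw [← mul_add]
            gcongr
            exact le_iSup₂ (f := fun v (_ : v ∈ Icc 0 u) => wPt α 0 h v) u ⟨hu.1.le, le_rfl⟩
        _ ≤ _ := by
            rw [lintegral_add_right _ (by fun_prop), lintegral_mul_const _ (by fun_prop)]
            gcongr
            exact lintegral_kernel_le hα hα' ⟨h0, ht.2⟩
    calc wPt α 0 h t ≤ _ := add_le_add (le_self_add) le_rfl
      _ ≤ _ := h1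
      _ ≤ K₁ * (C₁ * ((∫⁻ u in Ioo 0 t, kernel α t u * ⨆ v ∈ Icc 0 u, wPt α 0 h v) + B * ε)) := by
          gcongr
      _ = _ := by ring
  have hfin : ⨆ t ∈ Icc 0 T, wPt α 0 h t ≠ ∞ :=
    ne_top_of_le_ne_top (b := Kx + Kz) (by finiteness) (iSup₂_le hhK)
  refine iSup₂_le fun t ht => ?_
  exact (hgron _ _ hfin hmain t ht).trans (le_of_eq (by ring))

end solutions

end DelayEq

end

/-! ### Convergence as the delay vanishes. -/

theorem theorem4p3 {d m : ℕ} (T α β δ r₀ : ℝ) (hT : 0 < T)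
    (hβ : 0 < β) (hβ' : β ≤ 1) (hδ : 0 < δ) (hδ' : δ ≤ 1)
    (hα : 0 < α) (hα' : α < min (1 / 2) (min β (δ / (1 + δ)))) (hr₀ : 0 < r₀)
    (b : ℝ → EuclideanSpace ℝ (Fin d) → EuclideanSpace ℝ (Fin d))
    (σ : ℝ → EuclideanSpace ℝ (Fin d) → EuclideanSpace ℝ (Fin d × Fin m))
    (g : ℝ → EuclideanSpace ℝ (Fin m)) (η : ℝ → EuclideanSpace ℝ (Fin d))
    (hσ : DelayEq.HypH1 T β δ σ) (hb : DelayEq.HypH2' T (1 / α) b)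
    (hg : DelayEq.MemWT α T g)
    (hη : DelayEq.MemW α (-r₀) 0 η) (hη' : DelayEq.MemHolder (1 - α) (-r₀) 0 η)
    (x : ℝ → EuclideanSpace ℝ (Fin d))
    (hx : DelayEq.IsSolution α T b σ g (η 0) x)
    (xr : ℝ → ℝ → EuclideanSpace ℝ (Fin d))
    (hxr : ∀ r ∈ Set.Ioc 0 r₀, DelayEq.IsDelaySolution α T r b σ g η (xr r)) :
    Filter.Tendsto (fun r => DelayEq.wNorm α 0 T (fun t => x t - xr r t))
      (nhdsWithin 0 (Set.Ioi 0)) (nhds 0) := by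
  obtain ⟨hα2, hα'⟩ := lt_min_iff.1 hα'
  obtain ⟨hαβ, hαδ⟩ := lt_min_iff.1 hα'
  -- The condition α < δ/(1+δ) is equivalent to α(1+δ) < δ, that is, the exponent (1-α)δ exceeds α.
  have hκ : α < (1 - α) * δ := by
    rw [lt_div_iff₀ (by linarith)] at hαδ
    linarith
  obtain ⟨K, hK, hle⟩ := DelayEq.exists_wNorm_sub_le hT.le hδ hδ' hα hα2 hαβ hκ hσ hb hg hη hη' hx
  have hlim : Tendsto (fun r : ℝ => K * DelayEq.epow r (1 / 2 - α)) (𝓝[>] 0) (𝓝 0) := by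
    have hp : Tendsto (fun r : ℝ => r ^ (1 / 2 - α)) (𝓝[>] 0) (𝓝 0) := by
      have hc := (Real.continuousAt_rpow_const 0 (1 / 2 - α) (Or.inr (by linarith))).tendsto
      rw [Real.zero_rpow (by linarith)] at hc
      exact hc.mono_left nhdsWithin_le_nhds
    have h1 := ENNReal.tendsto_ofReal hp
    rw [ENNReal.ofReal_zero] at h1
    simpa [DelayEq.epow] using ENNReal.Tendsto.const_mul h1 (Or.inr hK)
  refine tendsto_of_tendsto_of_tendsto_of_le_of_le' tendsto_const_nhds hlim
    (Eventually.of_forall fun _ => zero_le) ?_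
  filter_upwards [Ioc_mem_nhdsGT hr₀] with r hr
  exact hle r hr (xr r) (hxr r hr)
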